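/- Let $d\ge 3$. Put $V^0=\{2y: y\in\mathbb Z^d,\ |y|_1=1\}$. The cable system $\tilde{\mathbb Z}^d\supset\mathbb Z^d$ is obtained by gluing, for each edge $\{x,x+\frac12v\}$ of $\mathbb Z^d$ ($x\in\mathbb Z^d$, $v\in V^0$), the segment $\{x+tv: 0\le t\le\frac12\}$ of length $\frac12$. Let $\tilde X$ be the canonical diffusion on $\tilde{\mathbb Z}^d$ (standard Brownian motion on the edges, leaving each vertex uniformly over the $2d$ attached edges, i.e. the diffusion with generator $f\mapsto\frac12f''$ on functions whose outgoing derivatives sum to $0$ at every vertex), with laws $\tilde P_z$ and continuous local times $L^y_t$ with respect to Lebesgue measure on $\tilde{\mathbb Z}^d$, and let $g(z,y)=\tilde E_z[L^y_\infty]$ be its Green function. Let $\tilde\Phi=(\tilde\Phi_z)_{z\in\tilde{\mathbb Z}^d}$ be, under $\tilde{\mathbb P}^G$, the Gaussian free field on $\tilde{\mathbb Z}^d$, i.e. the continuous centered Gaussian field with covariance $g$, and write $\Phi_x=\tilde\Phi_x$ for $x\in\mathbb Z^d$. Fix constants $C_0\ge1$ and $c_0>0$ and set $K(h)=\sqrt{\log(C_0h^{-c_0})}$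 for $h\in(0,1]$. For $x\in\mathbb Z^d$ and $v\in V^0$ let $U^{x,v}=\{x+tv: 0\le t<\frac14\}$ and $U^x=\bigcup_{v\in V^0}U^{x,v}$, let $\mathcal K^x=\partial U^x$ be the boundary of $U^x$ (which consists of the $2d$ points $x+\frac14v$), and let $\mathcal A_{\mathcal K^x}=\sigma(\tilde\Phi_z,\ z\in\mathcal K^x)$. Define the events $$E_h^{x,v}=\{\tilde\Phi_{x+\frac14v}\ge-h\}\cap\{\forall y\in\mathcal K^x:\ |\tilde\Phi_y|\le K(h)\},\qquad F_h^{x,v}=\{\forall z\in U^{x,v}:\ \tilde\Phi_z\ge-h\},$$ $$E_h^x=\bigcup_{v\in V^0}E_h^{x,v},\qquad G_h^x=\bigcup_{v\in V^0}\big(E_h^{x,v}\cap F_h^{x,v}\big).$$ Then there exists $h_1\in(0,1]$, depending only on $d$, $C_0$ and $c_0$, such that for all $h\in(0,h_1]$ and all $x\in\mathbb Z^d$, almost surely, $$\tilde{\mathbb P}^G\big(G_h^x\,\big|\,\mathcal A_{\mathcal K^x}\big)\ \le\ \tilde{\mathbb P}^G\big(E_h^x\cap\{\Phi_x\ge h\}\,\big|\,\mathcal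 A_{\mathcal K^x}\big).$$ -/

import Mathlib

open MeasureTheory ProbabilityTheory
open scoped NNReal ENNReal

noncomputable section

namespace CableGFF

/-- The set `V⁰ = {2y : |y|₁ = 1}` of the `2d` directions `±2eᵢ`. -/
def V0 (d : ℕ) : Finset (Fin d → ℤ) :=
  Finset.univ.image (fun i => Pi.single i 2) ∪ Finset.univ.image (fun i => Pi.single i (-2))

/-- The cable system of `ℤᵈ`: the vertices together with all points `x + t v` where
`x ∈ ℤᵈ`, `v ∈ V⁰` and `0 ≤ t ≤ 1/2`, with the topology inherited from `ℝᵈ`, which is that of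
intervals glued at their endpoints. The length of a piece of an edge is measured by the
parameter `t`, so every edge has length `1/2`. -/
abbrev Cable (d : ℕ) : Type :=
  {z : Fin d → ℝ //
    (∃ x : Fin d → ℤ, z = fun j => (x j : ℝ)) ∨
    ∃ x : Fin d → ℤ, ∃ v : V0 d, ∃ t : Set.Icc (0 : ℝ) (1 / 2),
      z = fun j => (x j : ℝ) + (t : ℝ) * ((v : Fin d → ℤ) j : ℝ)}

variable {d : ℕ}

/-- A vertex, as a point of the cable system. -/
def vertex (x : Fin d → ℤ) : Cable d := ⟨fun j => (x j : ℝ), Or.inl ⟨x, rfl⟩⟩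

/-- The point `x + t v` for `t ∈ [0, 1/2]` (for other `t`, the nearest endpoint is taken). -/
def point (x : Fin d → ℤ) (v : V0 d) (t : ℝ) : Cable d :=
  ⟨fun j => (x j : ℝ) + (Set.projIcc (0 : ℝ) (1 / 2) (by norm_num) t : ℝ)
      * ((v : Fin d → ℤ) j : ℝ),
    Or.inr ⟨x, v, Set.projIcc (0 : ℝ) (1 / 2) (by norm_num) t, rfl⟩⟩

/-- The positive direction `2eᵢ`. -/
def posDir (i : Fin d) : V0 d :=
  ⟨Pi.single i 2, Finset.mem_union_left _ (Finset.mem_image_of_mem _ (Finset.mem_univ i))⟩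

/-- Lebesgue measure on the cable system: the sum over all edges `{x, x + eᵢ}` (each counted
once) of Lebesgue measure on the interval `[0, 1/2]`. -/
def lebesgue (d : ℕ) : Measure (Cable d) :=
  Measure.sum fun e : (Fin d → ℤ) × Fin d =>
    (volume.restrict (Set.Icc (0 : ℝ) (1 / 2))).map (point e.1 (posDir e.2))

/-- `f` is a compactly supported test function in the domain of the generator of the diffusion,
with second derivative `u`: it is continuous, twice continuously differentiable on every closed
edge with second derivative `u` there, where `u` is continuous on the whole cable system, and at
every vertex the outgoing derivatives sum to zero. -/
structure IsKirchhoffTest (f u : Cable d → ℝ) : Prop where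
  continuous : Continuous f
  hasCompactSupport : HasCompactSupport f
  continuous_second : Continuous u
  contDiffOn_edge : ∀ (x : Fin d → ℤ) (v : V0 d),
    ContDiffOn ℝ 2 (fun t : ℝ => f (point x v t)) (Set.Icc 0 (1 / 2))
  second_eq : ∀ (x : Fin d → ℤ) (v : V0 d), ∀ t ∈ Set.Icc (0 : ℝ) (1 / 2),
    iteratedDerivWithin 2 (fun t : ℝ => f (point x v t)) (Set.Icc 0 (1 / 2)) t = u (point x v t)
  kirchhoff : ∀ x : Fin d → ℤ,
    ∑ v : V0 d, derivWithin (fun t : ℝ => f (point x v t)) (Set.Icc 0 (1 / 2)) 0 = 0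

/-- `X` under the laws `P z` is the diffusion on the cable system started at `z` (Brownian motion
on the edges, choosing at each vertex uniformly among the attached edges), given as the solution
of the martingale problem of its generator `f ↦ f'' / 2`, and `L t y` is its continuous field of
local times, i.e. the continuous density of the occupation measure of `X` up to time `t` with
respect to Lebesgue measure on the cable system. -/
structure IsCableDiffusion {W : Type*} [MeasurableSpace W] (P : Cable d → Measure W)
    (X : ℝ≥0 → W → Cable d) (L : ℝ≥0 → Cable d → W → ℝ≥0) : Prop where
  isProbabilityMeasure : ∀ z, IsProbabilityMeasure (P z)
  measurable : ∀ t, Measurable (X t)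
  continuous : ∀ w, Continuous fun t => X t w
  start : ∀ z, ∀ᵐ w ∂P z, X 0 w = z
  martingale : ∀ f u : Cable d → ℝ, IsKirchhoffTest f u → ∀ z,
    Martingale (fun (t : ℝ≥0) w => f (X t w) - ∫ s in (0 : ℝ)..t, u (X s.toNNReal w) / 2)
      (Filtration.natural X fun t => (measurable t).stronglyMeasurable) (P z)
  measurable_localTime : ∀ t y, Measurable (L t y)
  continuous_localTime : ∀ w, Continuous fun p : ℝ≥0 × Cable d => L p.1 p.2 w
  occupation : ∀ z, ∀ᵐ w ∂P z, ∀ t : ℝ≥0,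
    (volume.restrict (Set.Icc (0 : ℝ) t)).map (fun s => X s.toNNReal w)
      = (lebesgue d).withDensity fun y => (L t y w : ℝ≥0∞)

/-- The Green function `g(z, y) = E_z[L^y_∞]`. -/
def green {W : Type*} [MeasurableSpace W] (P : Cable d → Measure W)
    (L : ℝ≥0 → Cable d → W → ℝ≥0) (z y : Cable d) : ℝ≥0∞ :=
  ∫⁻ w, ⨆ t, (L t y w : ℝ≥0∞) ∂P z

/-- `φ` is under `μ` a continuous centered Gaussian field on the cable system with covariance
`g`; the covariance equation is one between extended real numbers. -/
structure IsGaussianField {Ω : Type*} [MeasurableSpace Ω] (g : Cable d → Cable d → ℝ≥0∞)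
    (μ : Measure Ω) (φ : Cable d → Ω → ℝ) : Prop where
  measurable : ∀ z, Measurable (φ z)
  continuous : ∀ ω, Continuous fun z => φ z ω
  gaussian : IsGaussianProcess φ μ
  centered : ∀ z, ∫ ω, φ z ω ∂μ = 0
  covariance : ∀ z y, ((∫ ω, φ z ω * φ y ω ∂μ : ℝ) : EReal) = (g z y : EReal)

/-- The half-open quarter-cable `U^{x,v} = x + [0, v/4)`. -/
def arm (x : Fin d → ℤ) (v : V0 d) : Set (Cable d) := point x v '' Set.Ico 0 (1 / 4)

/-- The star `U^x`, the union of the `2d` quarter-cables at `x`. -/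
def star (x : Fin d → ℤ) : Set (Cable d) := ⋃ v : V0 d, arm x v

/-- The boundary `K^x = ∂U^x` of the star. -/
def starBoundary (x : Fin d → ℤ) : Set (Cable d) := frontier (star x)

/-- The truncation height `K(h) = √(log (C₀ / h ^ c₀))`. -/
def truncation (C₀ c₀ h : ℝ) : ℝ := √(Real.log (C₀ / h ^ c₀))

section Events

variable {Ω : Type*} (φ : Cable d → Ω → ℝ) (C₀ c₀ h : ℝ) (x : Fin d → ℤ)

/-- The event `E_h^{x,v}`. -/
def eventEdir (v : V0 d) : Set Ω :=
  {ω | -h ≤ φ (point x v (1 / 4)) ω} ∩ {ω | ∀ y ∈ starBoundary x, |φ y ω| ≤ truncation C₀ c₀ h}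

/-- The event `F_h^{x,v}`. -/
def eventF (v : V0 d) : Set Ω := {ω | ∀ z ∈ arm x v, -h ≤ φ z ω}

/-- The event `E_h^x`. -/
def eventE : Set Ω := ⋃ v : V0 d, eventEdir φ C₀ c₀ h x v

/-- The event `G_h^x`. -/
def eventG : Set Ω := ⋃ v : V0 d, eventEdir φ C₀ c₀ h x v ∩ eventF φ h x v

/-- The σ-algebra `A_K` generated by the field on `K`. -/
abbrev fieldSigma (K : Set (Cable d)) : MeasurableSpace Ω :=
  ⨆ z ∈ K, MeasurableSpace.comap (φ z) inferInstance

end Events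

end CableGFF

end

/-! Write `N` for the number `2d` of arms. Given the boundary values `β` of the star, `Φ_x` is the
average `m β` plus an independent centred Gaussian of variance `1/(2N)`. The field at distance `h`
along each arm is the linear interpolation between `x` and the boundary point plus a centred
Gaussian of variance `2h(1-4h)` (a Brownian bridge of length `1/4`). These `N + 1` "innovations" are
independent of each other and of `β`.

Every arm contains `x`, so `G_h^x` forces `Φ_x ≥ -h`. Since `G_h^x ⊆ E_h^x`, it leaves `E_h^x ∩ {Φ_x
≥ h}` only in the window `-h ≤ Φ_x < h`. It therefore suffices to compare that window with a part of
`E_h^x ∩ {Φ_x ≥ h}` disjoint from `G_h^x`: the event that `h ≤ Φ_x` and the field at distance `h` is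
below `-h` on every arm (`measure_vertex_window_le`).

The truncation `|β| ≤ K(h)` with `√h K(h) → 0` enters twice. The density of `Φ_x` changes by a
factor at most `e` over `[-h, (M+1)h]`, so the window `[h, (M+1)h)` outweighs `[-h, h)` by a factor
of order `M` (`gaussianReal_window_le`). On that window the interpolations are `O(h + h K(h)) ≪ √h`,
while the bridges fluctuate on the scale `√h`; all of them fall far enough with probability at least
`q = P(N(0,1) < -1)^N`. Taking `M = 2e²/q` balances the two windows.

The conditional law is derived from the martingale problem. Integrating the generator in time gives
`∫ u g(z, ·) = -2f(z)` for test functions `f` with second derivative `u`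
(`integral_withDensity_green`). Test functions are `C²`, so `covariance_star` mollifies piecewise
linear functions on the star by small tents and passes to the limit. The resulting identities give
all covariances of the innovations, and Gaussianity turns zero covariance into independence. -/

noncomputable section

namespace CableGFF

variable {d : ℕ}

/-! ### Directions -/

/-- The negative direction `-2eᵢ`. -/
def negDir (i : Fin d) : V0 d :=
  ⟨Pi.single i (-2), Finset.mem_union_right _ (Finset.mem_image_of_mem _ (Finset.mem_univ i))⟩

lemma posDir_apply (i j : Fin d) : (posDir i : Fin d → ℤ) j = if j = i then 2 else 0 := by
  simp [posDir, Pi.single_apply]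

lemma negDir_apply (i j : Fin d) : (negDir i : Fin d → ℤ) j = if j = i then -2 else 0 := by
  simp [negDir, Pi.single_apply]

lemma dir_cases (v : V0 d) : (∃ i, v = posDir i) ∨ ∃ i, v = negDir i := by
  obtain ⟨v, hv⟩ := v
  simp only [V0, Finset.mem_union, Finset.mem_image, Finset.mem_univ, true_and] at hv
  rcases hv with ⟨i, rfl⟩ | ⟨i, rfl⟩
  · exact Or.inl ⟨i, rfl⟩
  · exact Or.inr ⟨i, rfl⟩

lemma dir_bijective :
    Function.Bijective (Sum.elim posDir negDir : Fin d ⊕ Fin d → V0 d) := by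
  constructor
  · rintro (i | i) (j | j) h
    all_goals
      have h1 := congrFun (congrArg Subtype.val h) i
      simp only [Sum.elim_inl, Sum.elim_inr, posDir_apply, negDir_apply] at h1
      split_ifs at h1 <;> simp_all
  · intro v
    rcases dir_cases v with ⟨i, rfl⟩ | ⟨i, rfl⟩
    · exact ⟨Sum.inl i, rfl⟩
    · exact ⟨Sum.inr i, rfl⟩

lemma sum_dir {M : Type*} [AddCommMonoid M] (F : V0 d → M) :
    ∑ v, F v = ∑ i, (F (posDir i) + F (negDir i)) := by
  rw [← (Equiv.ofBijective _ (dir_bijective (d := d))).sum_comp, Fintype.sum_sum_type,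
    Finset.sum_add_distrib]
  rfl

instance [NeZero d] : Nonempty (V0 d) := ⟨posDir 0⟩

/-- The Euclidean product of a vector with a direction. -/
lemma sum_mul_dir (v : V0 d) (a : Fin d → ℝ) :
    (∃ i, v = posDir i ∧ ∑ j, a j * ((v : Fin d → ℤ) j : ℝ) = 2 * a i) ∨
    (∃ i, v = negDir i ∧ ∑ j, a j * ((v : Fin d → ℤ) j : ℝ) = -2 * a i) := by
  rcases dir_cases v with ⟨i, rfl⟩ | ⟨i, rfl⟩
  · refine Or.inl ⟨i, rfl, ?_⟩
    rw [Finset.sum_eq_single i] <;> simp +contextual [posDir_apply, mul_comm]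
  · refine Or.inr ⟨i, rfl, ?_⟩
    rw [Finset.sum_eq_single i] <;> simp +contextual [negDir_apply, mul_comm]

lemma dir_mul_self (v : V0 d) :
    ∑ j, ((v : Fin d → ℤ) j : ℝ) * ((v : Fin d → ℤ) j : ℝ) = 4 := by
  rcases sum_mul_dir v (fun j => ((v : Fin d → ℤ) j : ℝ)) with ⟨i, rfl, h⟩ | ⟨i, rfl, h⟩ <;>
    rw [h] <;> simp [posDir_apply, negDir_apply] <;> norm_num

lemma dir_mul_of_ne {v w : V0 d} (hvw : v ≠ w) :
    ∑ j, ((w : Fin d → ℤ) j : ℝ) * ((v : Fin d → ℤ) j : ℝ) ≤ 0 := by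
  rcases sum_mul_dir v (fun j => ((w : Fin d → ℤ) j : ℝ)) with ⟨i, rfl, h⟩ | ⟨i, rfl, h⟩ <;>
    rw [h] <;> rcases dir_cases w with ⟨k, rfl⟩ | ⟨k, rfl⟩ <;>
    simp only [posDir_apply, negDir_apply] <;> split_ifs with hik <;>
    first | (exfalso; subst hik; exact hvw rfl) | norm_num

lemma norm_dir (v : V0 d) : ‖fun j => ((v : Fin d → ℤ) j : ℝ)‖ = 2 := by
  refine le_antisymm ((pi_norm_le_iff_of_nonneg (by norm_num)).2 fun j => ?_) ?_
  · rcases dir_cases v with ⟨k, rfl⟩ | ⟨k, rfl⟩ <;> simp only [posDir_apply, negDir_apply] <;>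
      split_ifs <;> norm_num
  · rcases dir_cases v with ⟨k, rfl⟩ | ⟨k, rfl⟩
    · refine le_trans ?_ (norm_le_pi_norm _ k)
      simp [posDir_apply]
    · refine le_trans ?_ (norm_le_pi_norm _ k)
      simp [negDir_apply]

/-! ### Points of the cable system -/

lemma point_coe {x : Fin d → ℤ} {v : V0 d} {t : ℝ} (ht : t ∈ Set.Icc (0 : ℝ) (1 / 2)) (j : Fin d) :
    (point x v t : Fin d → ℝ) j = x j + t * ((v : Fin d → ℤ) j : ℝ) := by
  simp only [point]
  rw [Set.projIcc_of_mem _ ht]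

lemma continuous_point (x : Fin d → ℤ) (v : V0 d) : Continuous (point x v) := by
  refine Continuous.subtype_mk (continuous_pi fun j => ?_) _
  exact continuous_const.add ((continuous_subtype_val.comp continuous_projIcc).mul continuous_const)

lemma zero_mem_Icc_half : (0 : ℝ) ∈ Set.Icc (0 : ℝ) (1 / 2) := by constructor <;> norm_num

lemma point_zero (x : Fin d → ℤ) (v : V0 d) : point x v 0 = vertex x := by
  ext j
  rw [point_coe zero_mem_Icc_half]
  simp [vertex]

lemma dist_point (x : Fin d → ℤ) (v : V0 d) {t : ℝ} (ht : t ∈ Set.Icc (0 : ℝ) (1 / 2)) :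
    dist (point x v t) (vertex x) = 2 * t := by
  rw [Subtype.dist_eq, dist_eq_norm]
  have : (point x v t : Fin d → ℝ) - (vertex x : Cable d) =
      t • fun j => ((v : Fin d → ℤ) j : ℝ) := by
    ext j
    simp [point_coe ht, vertex]
  rw [this, norm_smul, norm_dir, Real.norm_of_nonneg ht.1, mul_comm]

lemma abs_sub_le_dist (z : Cable d) (x : Fin d → ℤ) (j : Fin d) :
    |(z : Fin d → ℝ) j - x j| ≤ dist z (vertex x) := by
  rw [Subtype.dist_eq, ← Real.dist_eq]
  exact dist_le_pi_dist (z : Fin d → ℝ) (vertex x : Cable d) j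

lemma half_sub_mem {t : ℝ} (ht : t ∈ Set.Icc (0 : ℝ) (1 / 2)) :
    1 / 2 - t ∈ Set.Icc (0 : ℝ) (1 / 2) := ⟨by linarith [ht.2], by linarith [ht.1]⟩

/-- An edge parametrized from its other end. -/
lemma point_reverse_pos (x : Fin d → ℤ) (i : Fin d) {t : ℝ} (ht : t ∈ Set.Icc (0 : ℝ) (1 / 2)) :
    point (x - Pi.single i 1) (posDir i) t = point x (negDir i) (1 / 2 - t) := by
  ext j
  rw [point_coe ht, point_coe (half_sub_mem ht), posDir_apply, negDir_apply]
  by_cases h : j = i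
  · subst h; simp; ring
  · simp [h]

lemma point_reverse_neg (x : Fin d → ℤ) (i : Fin d) {t : ℝ} (ht : t ∈ Set.Icc (0 : ℝ) (1 / 2)) :
    point (x + Pi.single i 1) (negDir i) t = point x (posDir i) (1 / 2 - t) := by
  ext j
  rw [point_coe ht, point_coe (half_sub_mem ht), posDir_apply, negDir_apply]
  by_cases h : j = i
  · subst h; simp; ring
  · simp [h]

/-- An edge meeting the open unit ball around `x` has `x` as an end. -/
lemma edge_of_dist_lt_pos {x x' : Fin d → ℤ} {i : Fin d} {t : ℝ}
    (ht : t ∈ Set.Icc (0 : ℝ) (1 / 2)) (h : dist (point x' (posDir i) t) (vertex x) < 1) :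
    x' = x ∨ x' = x - Pi.single i 1 := by
  have hj : ∀ j, |(x' j : ℝ) + t * ((posDir i : Fin d → ℤ) j : ℝ) - x j| < 1 := fun j => by
    rw [← point_coe ht]
    exact (abs_sub_le_dist _ x j).trans_lt h
  have hne : ∀ j, j ≠ i → x' j = x j := fun j hji => by
    have := hj j
    simp only [posDir_apply, hji, if_false, Int.cast_zero, mul_zero, add_zero] at this
    have h2 : |x' j - x j| < 1 := by exact_mod_cast this
    rw [Int.abs_lt_one_iff] at h2
    omega
  have hi := abs_lt.1 (hj i)
  simp only [posDir_apply, if_true, Int.cast_ofNat] at hi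
  have h1 : (x' i : ℝ) < (x i + 1 : ℤ) := by push_cast; linarith [hi.2, ht.1]
  have h2 : ((x i - 2 : ℤ) : ℝ) < x' i := by push_cast; linarith [hi.1, ht.2]
  norm_cast at h1 h2
  rcases (show x' i = x i ∨ x' i = x i - 1 by omega) with h3 | h3
  · left
    ext j
    by_cases hji : j = i
    · rw [hji, h3]
    · exact hne j hji
  · right
    ext j
    by_cases hji : j = i
    · subst hji; simp [h3]
    · simp [hji, hne j hji]

lemma edge_of_dist_lt_neg {x x' : Fin d → ℤ} {i : Fin d} {t : ℝ}
    (ht : t ∈ Set.Icc (0 : ℝ) (1 / 2)) (h : dist (point x' (negDir i) t) (vertex x) < 1) :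
    x' = x ∨ x' = x + Pi.single i 1 := by
  have h1 : point x' (negDir i) t = point (x' - Pi.single i 1) (posDir i) (1 / 2 - t) := by
    rw [point_reverse_pos _ _ (half_sub_mem ht)]; congr 1; ring
  rw [h1] at h
  rcases edge_of_dist_lt_pos (half_sub_mem ht) h with h | h
  · right; rw [← h]; simp
  · left; simpa using h

lemma edge_of_dist_lt {x x' : Fin d → ℤ} {v' : V0 d} {t : ℝ} (ht : t ∈ Set.Icc (0 : ℝ) (1 / 2))
    (h : dist (point x' v' t) (vertex x) < 1) :
    x' = x ∨ ∃ v : V0 d, ∀ s ∈ Set.Icc (0 : ℝ) (1 / 2), point x' v' s = point x v (1 / 2 - s) := by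
  rcases dir_cases v' with ⟨i, rfl⟩ | ⟨i, rfl⟩
  · rcases edge_of_dist_lt_pos ht h with rfl | rfl
    · exact Or.inl rfl
    · exact Or.inr ⟨negDir i, fun s hs => point_reverse_pos x i hs⟩
  · rcases edge_of_dist_lt_neg ht h with rfl | rfl
    · exact Or.inl rfl
    · exact Or.inr ⟨posDir i, fun s hs => point_reverse_neg x i hs⟩

/-- The open unit ball around a vertex is a star. -/
lemma exists_point_of_dist_lt [NeZero d] {x : Fin d → ℤ} {z : Cable d}
    (h : dist z (vertex x) < 1) :
    ∃ v : V0 d, ∃ t ∈ Set.Icc (0 : ℝ) (1 / 2), z = point x v t := by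
  have hz : ∃ x' : Fin d → ℤ, ∃ v : V0 d, ∃ t ∈ Set.Icc (0 : ℝ) (1 / 2), z = point x' v t := by
    obtain ⟨z, ⟨x', rfl⟩ | ⟨x', v, t, rfl⟩⟩ := z
    · exact ⟨x', posDir 0, 0, zero_mem_Icc_half, (point_zero x' _).symm⟩
    · refine ⟨x', v, t, t.2, ?_⟩
      ext j
      rw [point_coe t.2]
  obtain ⟨x', v', t, ht, rfl⟩ := hz
  rcases edge_of_dist_lt ht h with rfl | ⟨v, hv⟩
  · exact ⟨v', t, ht, rfl⟩
  · exact ⟨v, 1 / 2 - t, half_sub_mem ht, hv t ht⟩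

/-! ### The star and its boundary -/

/-- Directions have sup norm `2`, so arm length `1/4` is distance `1/2`. As a ball the star is
visibly open and its frontier can be located by the distance to `x`. -/
lemma star_eq_ball [NeZero d] (x : Fin d → ℤ) : star x = Metric.ball (vertex x) (1 / 2) := by
  ext z
  simp only [star, arm, Set.mem_iUnion, Set.mem_image, Metric.mem_ball]
  constructor
  · rintro ⟨v, t, ht, rfl⟩
    rw [dist_point x v ⟨ht.1, by linarith [ht.2]⟩]
    linarith [ht.2]
  · intro h
    obtain ⟨v, t, ht, rfl⟩ := exists_point_of_dist_lt (h.trans (by norm_num))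
    rw [dist_point x v ht] at h
    exact ⟨v, t, ⟨ht.1, by linarith⟩, rfl⟩

lemma quarter_mem : (1 / 4 : ℝ) ∈ Set.Icc (0 : ℝ) (1 / 2) := by constructor <;> norm_num

lemma starBoundary_eq [NeZero d] (x : Fin d → ℤ) :
    starBoundary x = Set.range fun v : V0 d => point x v (1 / 4) := by
  ext z
  simp only [starBoundary, Set.mem_range]
  constructor
  · intro hz
    rw [star_eq_ball] at hz
    have h1 : dist z (vertex x) = 1 / 2 := Metric.frontier_ball_subset_sphere hz
    obtain ⟨v, t, ht, rfl⟩ := exists_point_of_dist_lt (h1.trans_lt (by norm_num))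
    rw [dist_point x v ht] at h1
    exact ⟨v, by congr 1; linarith⟩
  · rintro ⟨v, rfl⟩
    have hopen : IsOpen (star x) := by rw [star_eq_ball]; exact Metric.isOpen_ball
    rw [hopen.frontier_eq]
    constructor
    · have h1 : (1 / 4 : ℝ) ∈ closure (Set.Ico (0 : ℝ) (1 / 4)) := by
        rw [closure_Ico (by norm_num)]; constructor <;> norm_num
      have h2 : point x v (1 / 4) ∈ closure (point x v '' Set.Ico (0 : ℝ) (1 / 4)) :=
        image_closure_subset_closure_image (continuous_point x v) (Set.mem_image_of_mem _ h1)
      exact closure_mono (Set.subset_iUnion (arm x) v) h2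
    · rw [star_eq_ball, Metric.mem_ball, dist_point x v quarter_mem]
      norm_num

/-! ### Lebesgue measure on a star -/

lemma lintegral_lebesgue (φ : Cable d → ℝ≥0∞) (hφ : Measurable φ) :
    ∫⁻ z, φ z ∂lebesgue d =
      ∑' e : (Fin d → ℤ) × Fin d,
        ∫⁻ t in Set.Icc (0 : ℝ) (1 / 2), φ (point e.1 (posDir e.2) t) := by
  rw [lebesgue, lintegral_sum_measure]
  refine tsum_congr fun e => ?_
  rw [lintegral_map hφ (continuous_point _ _).measurable]

lemma setLIntegral_reflect (φ : ℝ → ℝ≥0∞) :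
    ∫⁻ t in Set.Icc (0 : ℝ) (1 / 2), φ (1 / 2 - t) = ∫⁻ t in Set.Icc (0 : ℝ) (1 / 2), φ t := by
  have h := (Measure.measurePreserving_sub_left volume (1 / 2 : ℝ)).setLIntegral_comp_emb
    (Homeomorph.subLeft (1 / 2 : ℝ)).measurableEmbedding φ (Set.Icc (0 : ℝ) (1 / 2))
  rw [h]
  simp

/-- The Lebesgue integral of a function that vanishes off the open unit ball around `x`. -/
lemma lintegral_lebesgue_of_star {x : Fin d → ℤ} {φ : Cable d → ℝ≥0∞} (hφ : Measurable φ)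
    (h0 : ∀ z, 1 ≤ dist z (vertex x) → φ z = 0) :
    ∫⁻ z, φ z ∂lebesgue d =
      ∑ v : V0 d, ∫⁻ t in Set.Icc (0 : ℝ) (1 / 2), φ (point x v t) := by
  rw [lintegral_lebesgue φ hφ, ENNReal.tsum_prod (f := fun x' i =>
    ∫⁻ t in Set.Icc (0 : ℝ) (1 / 2), φ (point x' (posDir i) t)), ENNReal.tsum_comm, tsum_fintype, sum_dir]
  refine Finset.sum_congr rfl fun i _ => ?_
  have hx : x ≠ x - Pi.single i 1 := fun h => by
    have := congrFun h i
    simp only [Pi.sub_apply, Pi.single_eq_same] at this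
    omega
  -- Each edge is counted once, from its lower end: along axis `i` only the edges based at `x` and
  -- at `x - eᵢ` meet the ball, and the latter is the arm `negDir i` run backwards.
  rw [tsum_eq_sum (s := {x, x - Pi.single i 1}), Finset.sum_pair hx]
  · congr 1
    rw [← setLIntegral_reflect]
    refine setLIntegral_congr_fun measurableSet_Icc fun t ht => ?_
    rw [point_reverse_pos x i (half_sub_mem ht), sub_sub_cancel]
  · intro x' hx'
    simp only [Finset.mem_insert, Finset.mem_singleton, not_or] at hx'
    refine (setLIntegral_congr_fun measurableSet_Icc fun t ht => h0 _ ?_).trans lintegral_zero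
    by_contra! hlt
    rcases edge_of_dist_lt_pos ht hlt with h | h
    · exact hx'.1 h
    · exact hx'.2 h

/-- Lebesgue measure on the star with arms of length `1/2` around `x`. -/
def starMeasure (x : Fin d → ℤ) : Measure (Cable d) :=
  ∑ v : V0 d, (volume.restrict (Set.Icc (0 : ℝ) (1 / 2))).map (point x v)

lemma lebesgue_restrict_ball (x : Fin d → ℤ) :
    (lebesgue d).restrict (Metric.ball (vertex x) 1) =
      (starMeasure x).restrict (Metric.ball (vertex x) 1) := by
  ext s hs
  have hm : MeasurableSet (s ∩ Metric.ball (vertex x) 1) := hs.inter measurableSet_ball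
  rw [Measure.restrict_apply hs, Measure.restrict_apply hs, ← lintegral_indicator_one hm,
    ← lintegral_indicator_one hm, lintegral_lebesgue_of_star (x := x)
      (measurable_one.indicator hm), starMeasure, lintegral_finsetSum_measure]
  · refine Finset.sum_congr rfl fun v _ => ?_
    rw [lintegral_map (measurable_one.indicator hm) (continuous_point _ _).measurable]
  · intro z hz
    refine Set.indicator_of_notMem (fun h => ?_) _
    exact absurd (Metric.mem_ball.1 h.2) (not_lt.2 hz)

/-- The integral of a continuous function that vanishes off the open unit ball around `x`. -/
lemma integral_lebesgue_of_star {x : Fin d → ℤ} {φ : Cable d → ℝ} (hφ : Continuous φ)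
    (h0 : ∀ z, 1 ≤ dist z (vertex x) → φ z = 0) :
    ∫ z, φ z ∂lebesgue d = ∑ v : V0 d, ∫ t in (0 : ℝ)..(1 / 2), φ (point x v t) := by
  have h0' : ∀ z ∉ Metric.ball (vertex x) 1, φ z = 0 := fun z hz =>
    h0 z (not_lt.1 fun h => hz (Metric.mem_ball.2 h))
  rw [← setIntegral_eq_integral_of_forall_compl_eq_zero h0', lebesgue_restrict_ball,
    setIntegral_eq_integral_of_forall_compl_eq_zero h0', starMeasure,
    integral_finsetSum_measure]
  · refine Finset.sum_congr rfl fun v _ => ?_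
    rw [integral_map (continuous_point _ _).aemeasurable hφ.aestronglyMeasurable,
      intervalIntegral.integral_of_le (by norm_num), integral_Icc_eq_integral_Ioc]
  · intro v _
    rw [integrable_map_measure hφ.aestronglyMeasurable (continuous_point _ _).aemeasurable]
    exact (hφ.comp (continuous_point x v)).integrableOn_Icc

/-! ### Test functions on a star -/

/-- The coordinate along the arm `v` at `x`; it vanishes on the other arms. -/
def armCoord (x : Fin d → ℤ) (v : V0 d) (z : Cable d) : ℝ :=
  max 0 ((∑ j, ((z : Fin d → ℝ) j - x j) * ((v : Fin d → ℤ) j : ℝ)) / 4)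

lemma continuous_armCoord (x : Fin d → ℤ) (v : V0 d) : Continuous (armCoord x v) := by
  refine continuous_const.max (Continuous.div_const (continuous_finsetSum _ fun j _ => ?_) _)
  exact (((continuous_apply j).comp continuous_subtype_val).sub continuous_const).mul
    continuous_const

/-- Directions have squared Euclidean length `4`, which explains the division, and distinct ones
have nonpositive product, so the positive part removes the other arms. -/
lemma armCoord_point (x : Fin d → ℤ) (v w : V0 d) {t : ℝ} (ht : t ∈ Set.Icc (0 : ℝ) (1 / 2)) :
    armCoord x v (point x w t) = if v = w then t else 0 := by
  have h : ∑ j, ((point x w t : Fin d → ℝ) j - x j) * ((v : Fin d → ℤ) j : ℝ) =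
      t * ∑ j, ((w : Fin d → ℤ) j : ℝ) * ((v : Fin d → ℤ) j : ℝ) := by
    rw [Finset.mul_sum]
    refine Finset.sum_congr rfl fun j _ => ?_
    rw [point_coe ht]
    ring
  rw [armCoord, h]
  split_ifs with hvw
  · subst hvw
    rw [dir_mul_self, mul_div_cancel_right₀ _ (by norm_num), max_eq_right ht.1]
  · refine max_eq_left ?_
    have := mul_nonpos_of_nonneg_of_nonpos ht.1 (dir_mul_of_ne hvw)
    linarith

/-- The function given by `F v` on the arm `v` at `x`, extended by zero; meaningful when all
`F v` have the value `c` at `0` and vanish on `[3/8, ∞)`. -/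
def starExtend (x : Fin d → ℤ) (c : ℝ) (F : V0 d → ℝ → ℝ) (z : Cable d) : ℝ :=
  if dist z (vertex x) ≤ 3 / 4 then c + ∑ v, (F v (armCoord x v z) - c) else 0

section starExtend

variable {x : Fin d → ℤ} {c : ℝ} {F : V0 d → ℝ → ℝ}

lemma starExtend_of_dist {z : Cable d} (hz : 3 / 4 < dist z (vertex x)) :
    starExtend x c F z = 0 := by
  rw [starExtend, if_neg (not_le.2 hz)]

/-- On the arm `w` every other coordinate is `0`, so each other summand is `c - c`. This makes one
globally continuous formula out of the `F v`. -/
lemma add_sum_arm (hc : ∀ v, F v 0 = c) (w : V0 d) {t : ℝ} (ht : t ∈ Set.Icc (0 : ℝ) (1 / 2)) :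
    c + ∑ v, (F v (armCoord x v (point x w t)) - c) = F w t := by
  rw [Finset.sum_eq_single w]
  · rw [armCoord_point x w w ht, if_pos rfl]; ring
  · intro v _ hv
    rw [armCoord_point x v w ht, if_neg hv, hc, sub_self]
  · simp

lemma starExtend_point (hc : ∀ v, F v 0 = c) (h0 : ∀ v, ∀ t, 3 / 8 ≤ t → F v t = 0)
    (w : V0 d) {t : ℝ} (ht : t ∈ Set.Icc (0 : ℝ) (1 / 2)) :
    starExtend x c F (point x w t) = F w t := by
  rw [starExtend]
  split_ifs with h
  · exact add_sum_arm hc w ht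
  · rw [dist_point x w ht] at h
    exact (h0 w t (by linarith)).symm

lemma continuous_starExtend [NeZero d] (hF : ∀ v, Continuous (F v)) (hc : ∀ v, F v 0 = c)
    (h0 : ∀ v, ∀ t, 3 / 8 ≤ t → F v t = 0) : Continuous (starExtend x c F) := by
  refine Continuous.if_le ?_ continuous_const (continuous_id.dist continuous_const)
    continuous_const fun z hz => ?_
  · exact continuous_const.add (continuous_finsetSum _ fun v _ =>
      ((hF v).comp (continuous_armCoord x v)).sub continuous_const)
  -- On the seam at distance `3/4`, that is at `t = 3/8`, both branches vanish.
  · obtain ⟨w, t, ht, rfl⟩ := exists_point_of_dist_lt (x := x) (z := z) (by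
      rw [hz]; norm_num)
    rw [add_sum_arm hc w ht]
    rw [dist_point x w ht] at hz
    exact h0 w t (by linarith)

lemma hasCompactSupport_starExtend [NeZero d] : HasCompactSupport (starExtend x c F) := by
  refine HasCompactSupport.intro (K := ⋃ v : V0 d, point x v '' Set.Icc 0 (1 / 2)) ?_ ?_
  · exact isCompact_iUnion fun v => isCompact_Icc.image (continuous_point x v)
  · intro z hz
    refine starExtend_of_dist (not_le.1 fun h => hz ?_)
    obtain ⟨v, t, ht, rfl⟩ := exists_point_of_dist_lt (h.trans_lt (by norm_num))
    exact Set.mem_iUnion.2 ⟨v, t, ht, rfl⟩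

end starExtend

section EdgeCalculus

variable {g H H' H'' : ℝ → ℝ}

lemma derivWithin_of_eqOn (hg : Set.EqOn g H (Set.Icc 0 (1 / 2))) (h1 : ∀ t, HasDerivAt H (H' t) t) :
    Set.EqOn (derivWithin g (Set.Icc 0 (1 / 2))) H' (Set.Icc 0 (1 / 2)) := fun t ht => by
  have hu : UniqueDiffWithinAt ℝ (Set.Icc (0 : ℝ) (1 / 2)) t :=
    uniqueDiffOn_Icc (by norm_num) t ht
  exact (((h1 t).hasDerivWithinAt).congr hg (hg ht)).derivWithin hu

lemma iteratedDerivWithin_two_of_eqOn (hg : Set.EqOn g H (Set.Icc 0 (1 / 2)))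
    (h1 : ∀ t, HasDerivAt H (H' t) t) (h2 : ∀ t, HasDerivAt H' (H'' t) t) :
    Set.EqOn (iteratedDerivWithin 2 g (Set.Icc 0 (1 / 2))) H'' (Set.Icc 0 (1 / 2)) :=
  fun t ht => by
  rw [iteratedDerivWithin_succ]
  refine derivWithin_of_eqOn (fun s hs => ?_) h2 ht
  rw [iteratedDerivWithin_one]
  exact derivWithin_of_eqOn hg h1 hs

lemma contDiff_two_of_hasDerivAt (h1 : ∀ t, HasDerivAt H (H' t) t)
    (h2 : ∀ t, HasDerivAt H' (H'' t) t) (h3 : Continuous H'') : ContDiff ℝ 2 H := by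
  have e1 : deriv H = H' := funext fun t => (h1 t).deriv
  have e2 : deriv H' = H'' := funext fun t => (h2 t).deriv
  rw [show (2 : WithTop ℕ∞) = 1 + 1 by norm_num, contDiff_succ_iff_deriv]
  refine ⟨fun t => (h1 t).differentiableAt, by simp, ?_⟩
  rw [e1, contDiff_one_iff_deriv, e2]
  exact ⟨fun t => (h2 t).differentiableAt, h3⟩

end EdgeCalculus

/-- Functions on the arms at `x` with a common value at `x`, a common second derivative at `x`,
and outgoing derivatives that sum to zero extend by zero to a test function. -/
lemma isKirchhoffTest_starExtend [NeZero d] {x : Fin d → ℤ} {c c' : ℝ} {F F' U : V0 d → ℝ → ℝ}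
    (h1 : ∀ v t, HasDerivAt (F v) (F' v t) t) (h2 : ∀ v t, HasDerivAt (F' v) (U v t) t)
    (h3 : ∀ v, Continuous (U v)) (hc : ∀ v, F v 0 = c) (hc' : ∀ v, U v 0 = c')
    (hF0 : ∀ v, ∀ t, 3 / 8 ≤ t → F v t = 0) (hF'0 : ∀ v, ∀ t, 3 / 8 ≤ t → F' v t = 0)
    (hU0 : ∀ v, ∀ t, 3 / 8 ≤ t → U v t = 0) (hsum : ∑ v, F' v 0 = 0) :
    IsKirchhoffTest (starExtend x c F) (starExtend x c' U) := by
  -- Test functions are checked on every edge from both of its ends. An edge either starts at `x`,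
  -- or stays outside the unit ball, or is an arm of `x` seen from its far end; in the last two
  -- cases the outgoing derivative at `x'` is zero.
  have key : ∀ (x' : Fin d → ℤ) (v' : V0 d), ∃ H H' H'' : ℝ → ℝ,
      (∀ t, HasDerivAt H (H' t) t) ∧ (∀ t, HasDerivAt H' (H'' t) t) ∧ Continuous H'' ∧
      Set.EqOn (fun t => starExtend x c F (point x' v' t)) H (Set.Icc 0 (1 / 2)) ∧
      Set.EqOn (fun t => starExtend x c' U (point x' v' t)) H'' (Set.Icc 0 (1 / 2)) ∧
      (x' ≠ x → H' 0 = 0) ∧ (x' = x → H' 0 = F' v' 0) := by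
    intro x' v'
    by_cases hx : x' = x
    · subst hx
      exact ⟨F v', F' v', U v', h1 v', h2 v', h3 v',
        fun t ht => starExtend_point hc hF0 v' ht, fun t ht => starExtend_point hc' hU0 v' ht,
        fun h => absurd rfl h, fun _ => rfl⟩
    by_cases h : ∀ t ∈ Set.Icc (0 : ℝ) (1 / 2), 1 ≤ dist (point x' v' t) (vertex x)
    · exact ⟨fun _ => 0, fun _ => 0, fun _ => 0, fun t => hasDerivAt_const _ _,
        fun t => hasDerivAt_const _ _, continuous_const,
        fun t ht => starExtend_of_dist (by linarith [h t ht]),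
        fun t ht => starExtend_of_dist (by linarith [h t ht]), fun _ => rfl,
        fun h => absurd h hx⟩
    · push Not at h
      obtain ⟨t, ht, hlt⟩ := h
      rcases edge_of_dist_lt ht hlt with h | ⟨v, hv⟩
      · exact absurd h hx
      · refine ⟨fun s => F v (1 / 2 - s), fun s => -F' v (1 / 2 - s), fun s => U v (1 / 2 - s),
          fun s => ?_, fun s => ?_, (h3 v).comp (continuous_const.sub continuous_id),
          fun s hs => ?_, fun s hs => ?_, fun _ => ?_, fun h => absurd h hx⟩
        · simpa using (h1 v (1 / 2 - s)).comp_const_sub (1 / 2) s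
        · have := ((h2 v (1 / 2 - s)).comp_const_sub (1 / 2) s).neg
          rwa [neg_neg] at this
        · simp only [hv s hs, starExtend_point hc hF0 v (half_sub_mem hs)]
        · simp only [hv s hs, starExtend_point hc' hU0 v (half_sub_mem hs)]
        · simp only [hF'0 v (1 / 2 - 0) (by norm_num), neg_zero]
  have hFc : ∀ v, Continuous (F v) := fun v =>
    continuous_iff_continuousAt.2 fun t => (h1 v t).continuousAt
  refine ⟨continuous_starExtend hFc hc hF0, hasCompactSupport_starExtend,
    continuous_starExtend h3 hc' hU0, fun x' v' => ?_, fun x' v' t ht => ?_, fun x' => ?_⟩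
  · obtain ⟨H, H', H'', k1, k2, k3, e1, -⟩ := key x' v'
    exact ((contDiff_two_of_hasDerivAt k1 k2 k3).contDiffOn).congr e1
  · obtain ⟨H, H', H'', k1, k2, k3, e1, e2, -⟩ := key x' v'
    exact (iteratedDerivWithin_two_of_eqOn e1 k1 k2 ht).trans (e2 ht).symm
  · by_cases hx : x' = x
    · refine (Finset.sum_congr rfl fun v' _ => ?_).trans hsum
      obtain ⟨H, H', H'', k1, k2, k3, e1, -, -, e3⟩ := key x' v'
      rw [derivWithin_of_eqOn e1 k1 zero_mem_Icc_half, e3 hx]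
    · refine Finset.sum_eq_zero fun v' _ => ?_
      obtain ⟨H, H', H'', k1, k2, k3, e1, -, e3, -⟩ := key x' v'
      rw [derivWithin_of_eqOn e1 k1 zero_mem_Icc_half, e3 hx]

/-! ### Occupation times -/

lemma ae_le_of_withDensity_le {α : Type*} [MeasurableSpace α] {μ : Measure α} {f g : α → ℝ≥0∞}
    (hf : Measurable f) (hg : Measurable g) (hfi : ∫⁻ a, f a ∂μ ≠ ∞)
    (h : μ.withDensity f ≤ μ.withDensity g) : f ≤ᵐ[μ] g := by
  have hs : MeasurableSet {a | g a < f a} := measurableSet_lt hg hf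
  rw [Filter.EventuallyLE, ae_iff]
  simp only [not_le]
  by_contra hne
  have h1 : ∫⁻ a in {a | g a < f a}, g a ∂μ ≠ ∞ := by
    refine ne_top_of_le_ne_top hfi (le_trans ?_ (setLIntegral_le_lintegral {a | g a < f a} f))
    exact setLIntegral_mono hf fun a ha => le_of_lt ha
  have h2 := setLIntegral_strict_mono hs hne hf h1 (ae_of_all _ fun a ha => ha)
  have h3 := h {a | g a < f a}
  rw [withDensity_apply _ hs, withDensity_apply _ hs] at h3
  exact absurd h3 (not_le.2 h2)

lemma iSup_eq_iSup_denseSeq {F : ℝ≥0 → ℝ≥0∞} (hF : Continuous F) :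
    ⨆ t, F t = ⨆ n, F (TopologicalSpace.denseSeq ℝ≥0 n) := by
  refine le_antisymm (iSup_le fun t => ?_) (iSup_le fun n => le_iSup F _)
  refine (TopologicalSpace.denseRange_denseSeq ℝ≥0).induction_on
    (p := fun t => F t ≤ ⨆ n, F (TopologicalSpace.denseSeq ℝ≥0 n)) t
    (isClosed_le hF continuous_const) fun n => ?_
  exact le_iSup (fun n => F (TopologicalSpace.denseSeq ℝ≥0 n)) n

instance : SFinite (lebesgue d) := by
  unfold lebesgue
  infer_instance

section Diffusion

variable {W : Type*} [MeasurableSpace W] {P : Cable d → Measure W}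
  {X : ℝ≥0 → W → Cable d} {L : ℝ≥0 → Cable d → W → ℝ≥0}

lemma IsCableDiffusion.measurable_uncurry (hX : IsCableDiffusion P X L) :
    Measurable fun p : W × ℝ => X p.2.toNNReal p.1 := by
  have h : Measurable (Function.uncurry X) :=
    measurable_uncurry_of_continuous_of_measurable hX.continuous hX.measurable
  exact h.comp ((measurable_snd.real_toNNReal).prodMk measurable_fst)

lemma IsCableDiffusion.continuous_localTime_time (hX : IsCableDiffusion P X L) (y : Cable d)
    (w : W) : Continuous fun t => (L t y w : ℝ≥0∞) :=
  ENNReal.continuous_coe.comp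
    ((hX.continuous_localTime w).comp (continuous_id.prodMk continuous_const))

lemma IsCableDiffusion.measurable_localTime_space (hX : IsCableDiffusion P X L) (t : ℝ≥0)
    (w : W) : Measurable fun y => (L t y w : ℝ≥0∞) :=
  (ENNReal.continuous_coe.comp
    ((hX.continuous_localTime w).comp (continuous_const.prodMk continuous_id))).measurable

lemma IsCableDiffusion.measurable_localTime_prod (hX : IsCableDiffusion P X L) (t : ℝ≥0) :
    Measurable fun p : W × Cable d => (L t p.2 p.1 : ℝ≥0∞) := by
  have h : Measurable (Function.uncurry (L t)) :=
    measurable_uncurry_of_continuous_of_measurable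
      (fun w => (hX.continuous_localTime w).comp (continuous_const.prodMk continuous_id))
      (hX.measurable_localTime t)
  exact (h.comp measurable_swap).coe_nnreal_ennreal

lemma IsCableDiffusion.measurable_iSup_localTime (hX : IsCableDiffusion P X L) :
    Measurable fun p : W × Cable d => ⨆ t, (L t p.2 p.1 : ℝ≥0∞) := by
  simp_rw [fun p : W × Cable d => iSup_eq_iSup_denseSeq (hX.continuous_localTime_time p.2 p.1)]
  exact Measurable.iSup fun n => hX.measurable_localTime_prod _

lemma IsCableDiffusion.measurable_green (hX : IsCableDiffusion P X L) (z : Cable d) :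
    Measurable (green P L z) := by
  have := hX.isProbabilityMeasure z
  exact hX.measurable_iSup_localTime.lintegral_prod_left'

lemma IsCableDiffusion.ae_lintegral_occupation (hX : IsCableDiffusion P X L) (z : Cable d) :
    ∀ᵐ w ∂P z, ∀ t : ℝ≥0, ∀ φ : Cable d → ℝ≥0∞, Measurable φ →
      ∫⁻ s in Set.Ioc (0 : ℝ) t, φ (X s.toNNReal w) = ∫⁻ y, L t y w * φ y ∂lebesgue d := by
  filter_upwards [hX.occupation z] with w hw t φ hφ
  have hXw : Measurable fun s : ℝ => X s.toNNReal w :=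
    ((hX.continuous w).comp continuous_real_toNNReal).measurable
  rw [Measure.restrict_congr_set Ioc_ae_eq_Icc, ← lintegral_map hφ hXw, hw t,
    lintegral_withDensity_eq_lintegral_mul _ (hX.measurable_localTime_space t w) hφ]
  rfl

/-- Monotonicity in time is not part of `IsCableDiffusion`; it follows, for almost every `y`, from
the growth of the occupation measures. -/
lemma IsCableDiffusion.ae_localTime_mono (hX : IsCableDiffusion P X L) (z : Cable d) :
    ∀ᵐ w ∂P z, ∀ s t : ℝ≥0, s ≤ t → ∀ᵐ y ∂lebesgue d, (L s y w : ℝ≥0∞) ≤ L t y w := by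
  filter_upwards [hX.occupation z] with w hw s t hst
  refine ae_le_of_withDensity_le (hX.measurable_localTime_space s w)
    (hX.measurable_localTime_space t w) ?_ ?_
  · have hXw : Measurable fun s : ℝ => X s.toNNReal w :=
      ((hX.continuous w).comp continuous_real_toNNReal).measurable
    rw [← setLIntegral_univ, ← withDensity_apply _ MeasurableSet.univ, ← hw s,
      Measure.map_apply hXw MeasurableSet.univ]
    exact measure_ne_top _ _
  · rw [← hw s, ← hw t]
    refine Measure.map_mono (Measure.restrict_mono (Set.Icc_subset_Icc_right ?_) le_rfl)
      ((hX.continuous w).comp continuous_real_toNNReal).measurable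
    exact_mod_cast hst

lemma iUnion_Ioc_zero_nat : ⋃ n : ℕ, Set.Ioc (0 : ℝ) ((n : ℝ≥0) : ℝ) = Set.Ioi 0 := by
  ext s
  simp only [Set.mem_iUnion, Set.mem_Ioc, Set.mem_Ioi, NNReal.coe_natCast, exists_and_left,
    and_iff_left_iff_imp]
  exact fun _ => exists_nat_ge s

/-- The total occupation measure has the total local time as its density. -/
lemma IsCableDiffusion.ae_lintegral_total_occupation (hX : IsCableDiffusion P X L) (z : Cable d) :
    ∀ᵐ w ∂P z, ∀ φ : Cable d → ℝ≥0∞, Measurable φ →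
      ∫⁻ s in Set.Ioi (0 : ℝ), φ (X s.toNNReal w) =
        ∫⁻ y, (⨆ t, (L t y w : ℝ≥0∞)) * φ y ∂lebesgue d := by
  filter_upwards [hX.ae_lintegral_occupation z, hX.ae_localTime_mono z] with w h1 h2 φ hφ
  have hmono : ∀ᵐ y ∂lebesgue d, Monotone fun n : ℕ => (L (n : ℝ≥0) y w : ℝ≥0∞) := by
    have : ∀ᵐ y ∂lebesgue d, ∀ n : ℕ, (L (n : ℝ≥0) y w : ℝ≥0∞) ≤ L ((n + 1 : ℕ) : ℝ≥0) y w :=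
      ae_all_iff.2 fun n => h2 _ _ (by exact_mod_cast Nat.le_succ n)
    filter_upwards [this] with y hy using monotone_nat_of_le_succ hy
  -- Every time of a countable dense sequence is dominated by an integer time, so only countably
  -- many null sets are discarded and monotone convergence along the integers applies.
  have hsup : ∀ᵐ y ∂lebesgue d,
      (⨆ t, (L t y w : ℝ≥0∞)) = ⨆ n : ℕ, (L (n : ℝ≥0) y w : ℝ≥0∞) := by
    have : ∀ᵐ y ∂lebesgue d, ∀ k : ℕ, (L (TopologicalSpace.denseSeq ℝ≥0 k) y w : ℝ≥0∞) ≤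
        L (⌈TopologicalSpace.denseSeq ℝ≥0 k⌉₊ : ℝ≥0) y w :=
      ae_all_iff.2 fun k => h2 _ _ (Nat.le_ceil _)
    filter_upwards [this] with y hy
    refine le_antisymm ?_ (iSup_le fun n => le_iSup (fun t => (L t y w : ℝ≥0∞)) _)
    rw [iSup_eq_iSup_denseSeq (hX.continuous_localTime_time y w)]
    exact iSup_le fun k => (hy k).trans (le_iSup (fun n : ℕ => (L (n : ℝ≥0) y w : ℝ≥0∞)) _)
  rw [← iUnion_Ioc_zero_nat, setLIntegral_iUnion_of_directed]
  · simp_rw [h1 _ φ hφ]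
    rw [← lintegral_iSup']
    · refine lintegral_congr_ae ?_
      filter_upwards [hsup] with y hy
      rw [hy, ENNReal.iSup_mul]
    · exact fun n => ((hX.measurable_localTime_space _ w).mul hφ).aemeasurable
    · filter_upwards [hmono] with y hy n m hnm
      exact mul_le_mul_left (hy hnm) _
  · exact Monotone.directed_le fun n m hnm => Set.Ioc_subset_Ioc_right (by exact_mod_cast hnm)

/-- The expected occupation measure of the diffusion has the Green function as its density. -/
lemma IsCableDiffusion.map_prod_eq_withDensity_green (hX : IsCableDiffusion P X L)
    (z : Cable d) :
    ((P z).prod (volume.restrict (Set.Ioi (0 : ℝ)))).map (fun p => X p.2.toNNReal p.1) =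
      (lebesgue d).withDensity (green P L z) := by
  have := hX.isProbabilityMeasure z
  ext A hA
  have hφ : Measurable (A.indicator (1 : Cable d → ℝ≥0∞)) := measurable_one.indicator hA
  rw [← lintegral_indicator_one hA, ← lintegral_indicator_one hA,
    lintegral_map hφ hX.measurable_uncurry,
    lintegral_prod (fun p : W × ℝ => A.indicator 1 (X p.2.toNNReal p.1))
      (hφ.comp hX.measurable_uncurry).aemeasurable,
    lintegral_withDensity_eq_lintegral_mul _ (hX.measurable_green z) hφ]
  have h1 : ∀ᵐ w ∂P z, ∫⁻ s in Set.Ioi (0 : ℝ), A.indicator 1 (X s.toNNReal w) =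
      ∫⁻ y, (⨆ t, (L t y w : ℝ≥0∞)) * A.indicator 1 y ∂lebesgue d := by
    filter_upwards [hX.ae_lintegral_total_occupation z] with w hw using hw _ hφ
  rw [lintegral_congr_ae h1, lintegral_lintegral_swap]
  · refine lintegral_congr fun y => ?_
    have hy : Measurable fun w => ⨆ t, (L t y w : ℝ≥0∞) :=
      hX.measurable_iSup_localTime.comp measurable_prodMk_right
    rw [lintegral_mul_const _ hy]
    rfl
  · exact (hX.measurable_iSup_localTime.mul (hφ.comp measurable_snd)).aemeasurable

/-! ### The potential of a second derivative -/

lemma IsCableDiffusion.integral_test (hX : IsCableDiffusion P X L) {f u : Cable d → ℝ}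
    (hfu : IsKirchhoffTest f u) (z : Cable d) (hcu : HasCompactSupport u) (t : ℝ≥0) :
    ∫ w, f (X t w) ∂P z =
      f z + ∫ s in (0 : ℝ)..t, ∫ w, u (X s.toNNReal w) / 2 ∂P z := by
  have := hX.isProbabilityMeasure z
  have hM := hX.martingale f u hfu z
  have h1 := hM.setIntegral_eq (zero_le : (0 : ℝ≥0) ≤ t) MeasurableSet.univ
  simp only [Measure.restrict_univ, NNReal.coe_zero, intervalIntegral.integral_same,
    sub_zero] at h1
  have h2 : ∫ w, f (X 0 w) ∂P z = f z := by
    rw [integral_congr_ae (g := fun _ => f z)]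
    · simp
    · filter_upwards [hX.start z] with w hw
      rw [hw]
  obtain ⟨Cf, hCf⟩ := hfu.hasCompactSupport.exists_bound_of_continuous hfu.continuous
  obtain ⟨Cu, hCu⟩ := hcu.exists_bound_of_continuous hfu.continuous_second
  have hfi : Integrable (fun w => f (X t w)) (P z) :=
    Integrable.of_bound (hfu.continuous.measurable.comp (hX.measurable t)).aestronglyMeasurable
      Cf (ae_of_all _ fun w => hCf _)
  have hprod : Integrable (fun p : W × ℝ => u (X p.2.toNNReal p.1) / 2)
      ((P z).prod (volume.restrict (Set.Ioc (0 : ℝ) t))) :=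
    Integrable.of_bound ((hfu.continuous_second.measurable.comp
      hX.measurable_uncurry).div_const 2).aestronglyMeasurable (Cu / 2) (ae_of_all _ fun p => by
        rw [norm_div, Real.norm_ofNat]
        exact div_le_div_of_nonneg_right (hCu _) (by norm_num))
  have hii : Integrable (fun w => ∫ s in (0 : ℝ)..t, u (X s.toNNReal w) / 2) (P z) := by
    simp_rw [intervalIntegral.integral_of_le t.coe_nonneg]
    exact hprod.integral_prod_left
  rw [integral_sub hfi hii, h2] at h1
  have h3 : ∫ w, (∫ s in (0 : ℝ)..t, u (X s.toNNReal w) / 2) ∂P z =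
      ∫ s in (0 : ℝ)..t, ∫ w, u (X s.toNNReal w) / 2 ∂P z := by
    simp_rw [intervalIntegral.integral_of_le t.coe_nonneg]
    exact integral_integral_swap hprod
  linarith

/-- The Green potential of the second derivative of a test function `f` is `-2 f`. -/
lemma IsCableDiffusion.integral_withDensity_green (hX : IsCableDiffusion P X L)
    {f u : Cable d → ℝ} (hfu : IsKirchhoffTest f u) (z : Cable d) (hcu : HasCompactSupport u)
    (hf : Integrable f ((lebesgue d).withDensity (green P L z)))
    (hu : Integrable u ((lebesgue d).withDensity (green P L z))) :
    ∫ y, u y ∂(lebesgue d).withDensity (green P L z) = -2 * f z := by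
  have := hX.isProbabilityMeasure z
  rw [← hX.map_prod_eq_withDensity_green z] at hf hu ⊢
  have hXm := hX.measurable_uncurry.aemeasurable
    (μ := (P z).prod (volume.restrict (Set.Ioi (0 : ℝ))))
  rw [integral_map hXm hfu.continuous_second.aestronglyMeasurable]
  rw [integrable_map_measure hfu.continuous.aestronglyMeasurable hXm] at hf
  rw [integrable_map_measure hfu.continuous_second.aestronglyMeasurable hXm] at hu
  -- Integrability of `f` against the Green measure makes `t ↦ E_z f(X_t)` integrable on `(0, ∞)`.
  -- It also converges as `t → ∞`, because the integral of `u` does, so its limit is `0`. Transience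
  -- enters only through this integrability.
  have hm : IntegrableOn (fun s : ℝ => ∫ w, f (X s.toNNReal w) ∂P z) (Set.Ioi 0) :=
    hf.integral_prod_right
  have hk : IntegrableOn (fun s : ℝ => ∫ w, u (X s.toNNReal w) / 2 ∂P z) (Set.Ioi 0) :=
    (hu.div_const 2).integral_prod_right
  have hlim : Filter.Tendsto (fun t : ℝ => ∫ w, f (X t.toNNReal w) ∂P z) Filter.atTop
      (nhds (f z + ∫ s in Set.Ioi (0 : ℝ), ∫ w, u (X s.toNNReal w) / 2 ∂P z)) := by
    refine Filter.Tendsto.congr' ?_ (tendsto_const_nhds.add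
      (intervalIntegral_tendsto_integral_Ioi 0 hk Filter.tendsto_id))
    filter_upwards [Filter.eventually_ge_atTop 0] with t ht
    rw [hX.integral_test hfu z hcu, Real.coe_toNNReal t ht, id]
  have h0 := IntegrableAtFilter.eq_zero_of_tendsto (μ := volume)
    ⟨Set.Ioi 0, Filter.Ioi_mem_atTop 0, hm⟩ (fun s hs => by
      obtain ⟨b, hb⟩ := Filter.mem_atTop_sets.1 hs
      exact measure_mono_top (fun y hy => hb y hy) (Real.volume_Ici (a := b))) hlim
  have h1 : ∫ s in Set.Ioi (0 : ℝ), ∫ w, u (X s.toNNReal w) / 2 ∂P z =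
      (∫ p, u (X p.2.toNNReal p.1) ∂(P z).prod (volume.restrict (Set.Ioi (0 : ℝ)))) / 2 := by
    rw [← integral_div, integral_prod_symm (fun p : W × ℝ => u (X p.2.toNNReal p.1) / 2)
      (hu.div_const 2)]
  linarith

end Diffusion

/-! ### A twice integrated tent function -/

/-- Powers at least two of the positive part are `C¹`. Away from `0` this is clear, and at `0` the
derivative extends continuously. -/
lemma hasDerivAt_max_pow (n : ℕ) (t : ℝ) :
    HasDerivAt (fun s : ℝ => max s 0 ^ (n + 2)) ((n + 2) * max t 0 ^ (n + 1)) t := by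
  have hne : ∀ s : ℝ, s ≠ 0 →
      HasDerivAt (fun s : ℝ => max s 0 ^ (n + 2)) ((n + 2) * max s 0 ^ (n + 1)) s := by
    intro s hs
    rcases lt_or_gt_of_ne hs with hs | hs
    · rw [max_eq_right hs.le, zero_pow (by omega), mul_zero]
      refine (hasDerivAt_const s (0 : ℝ)).congr_of_eventuallyEq ?_
      filter_upwards [Iio_mem_nhds hs] with r hr
      rw [max_eq_right (le_of_lt hr), zero_pow (by omega)]
    · rw [max_eq_left hs.le]
      have h := hasDerivAt_pow (n + 2) s
      rw [show n + 2 - 1 = n + 1 by omega] at h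
      push_cast at h
      refine h.congr_of_eventuallyEq ?_
      filter_upwards [Ioi_mem_nhds hs] with r hr
      rw [max_eq_left (le_of_lt hr)]
  by_cases ht : t = 0
  · subst ht
    have hc1 : Continuous fun s : ℝ => max s 0 ^ (n + 2) := by fun_prop
    have hc2 : Continuous fun s : ℝ => ((n : ℝ) + 2) * max s 0 ^ (n + 1) := by fun_prop
    exact hasDerivAt_of_hasDerivAt_of_ne hne hc1.continuousAt hc2.continuousAt
  · exact hne t ht

/-- The tent function `(1 - |t|)⁺`. -/
def tent (t : ℝ) : ℝ := max (1 - t) 0 - 2 * max (-t) 0 + max (-1 - t) 0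

/-- The primitive of `tent` that vanishes at `+∞`. -/
def tentPrim (t : ℝ) : ℝ := -(max (1 - t) 0 ^ 2 - 2 * max (-t) 0 ^ 2 + max (-1 - t) 0 ^ 2) / 2

/-- The primitive of `tentPrim` that vanishes at `+∞`. -/
def tentPrim₂ (t : ℝ) : ℝ := (max (1 - t) 0 ^ 3 - 2 * max (-t) 0 ^ 3 + max (-1 - t) 0 ^ 3) / 6

lemma continuous_tent : Continuous tent := by unfold tent; fun_prop

lemma hasDerivAt_max_sub_pow (n : ℕ) (a t : ℝ) :
    HasDerivAt (fun s : ℝ => max (a - s) 0 ^ (n + 2)) (-((n + 2) * max (a - t) 0 ^ (n + 1))) t :=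
  (hasDerivAt_max_pow n (a - t)).comp_const_sub a t

lemma hasDerivAt_tentPrim (t : ℝ) : HasDerivAt tentPrim (tent t) t := by
  have h := ((((hasDerivAt_max_sub_pow 0 1 t).sub
    ((hasDerivAt_max_sub_pow 0 0 t).const_mul 2)).add (hasDerivAt_max_sub_pow 0 (-1) t)).neg).div_const 2
  simp only [zero_sub] at h
  convert! h using 1
  simp only [tent]
  push_cast
  ring

lemma hasDerivAt_tentPrim₂ (t : ℝ) : HasDerivAt tentPrim₂ (tentPrim t) t := by
  have h := (((hasDerivAt_max_sub_pow 1 1 t).sub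
    ((hasDerivAt_max_sub_pow 1 0 t).const_mul 2)).add (hasDerivAt_max_sub_pow 1 (-1) t)).div_const 6
  simp only [zero_sub] at h
  convert! h using 1
  simp only [tentPrim]
  push_cast
  ring

lemma tent_of_one_le {t : ℝ} (ht : 1 ≤ t) : tent t = 0 ∧ tentPrim t = 0 ∧ tentPrim₂ t = 0 := by
  simp [tent, tentPrim, tentPrim₂, max_eq_right (show 1 - t ≤ 0 by linarith),
    max_eq_right (show -t ≤ 0 by linarith), max_eq_right (show -1 - t ≤ 0 by linarith)]

lemma tent_of_le_neg_one {t : ℝ} (ht : t ≤ -1) :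
    tent t = 0 ∧ tentPrim t = -1 ∧ tentPrim₂ t = -t := by
  simp only [tent, tentPrim, tentPrim₂, max_eq_left (show 0 ≤ 1 - t by linarith),
    max_eq_left (show 0 ≤ -t by linarith), max_eq_left (show 0 ≤ -1 - t by linarith)]
  refine ⟨by ring, by ring, by ring⟩

lemma tentPrim_zero : tentPrim 0 = -1 / 2 := by norm_num [tentPrim]

lemma tent_of_mem_Icc {t : ℝ} (ht : t ∈ Set.Icc (0 : ℝ) 1) : tent t = 1 - t := by
  simp [tent, max_eq_left (show 0 ≤ 1 - t by linarith [ht.2]),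
    max_eq_right (show -t ≤ 0 by linarith [ht.1]), max_eq_right (show -1 - t ≤ 0 by linarith [ht.1])]

lemma tent_of_mem_Icc_neg {t : ℝ} (ht : t ∈ Set.Icc (-1 : ℝ) 0) : tent t = 1 + t := by
  simp only [tent, max_eq_left (show 0 ≤ 1 - t by linarith [ht.2]),
    max_eq_left (show 0 ≤ -t by linarith [ht.2]), max_eq_right (show -1 - t ≤ 0 by linarith [ht.1])]
  ring

lemma integral_tent_right : ∫ t in (0 : ℝ)..1, tent t = 1 / 2 := by
  rw [intervalIntegral.integral_congr (g := fun t => 1 - t)]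
  · rw [intervalIntegral.integral_comp_sub_left (fun t => t) 1, integral_id]
    norm_num
  · intro t ht
    rw [Set.uIcc_of_le zero_le_one] at ht
    exact tent_of_mem_Icc ht

lemma integral_tent : ∫ t in (-1 : ℝ)..1, tent t = 1 := by
  rw [← intervalIntegral.integral_add_adjacent_intervals (b := 0)
    (continuous_tent.intervalIntegrable _ _) (continuous_tent.intervalIntegrable _ _),
    integral_tent_right, intervalIntegral.integral_congr (a := -1) (g := fun t => 1 + t)]
  · rw [intervalIntegral.integral_comp_add_left (fun t => t) 1, integral_id]
    norm_num
  · intro t ht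
    rw [Set.uIcc_of_le (by norm_num)] at ht
    exact tent_of_mem_Icc_neg ht

/-! ### Concentration of rescaled tents -/

lemma integral_eq_of_eq_zero_off {f : ℝ → ℝ} (hf : Continuous f) {a b p q : ℝ} (hap : a ≤ p)
    (hqb : q ≤ b) (hp : ∀ t, a < t → t ≤ p → f t = 0) (hq : ∀ t, q ≤ t → f t = 0) :
    ∫ t in a..b, f t = ∫ t in p..q, f t := by
  have h1 : ∫ t in a..p, f t = 0 := by
    refine intervalIntegral.integral_zero_ae (ae_of_all _ fun t ht => ?_)
    rw [Set.uIoc_of_le hap] at ht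
    exact hp t ht.1 ht.2
  have h2 : ∫ t in q..b, f t = 0 := by
    refine intervalIntegral.integral_zero_ae (ae_of_all _ fun t ht => ?_)
    rw [Set.uIoc_of_le hqb] at ht
    exact hq t ht.1.le
  rw [← intervalIntegral.integral_add_adjacent_intervals (hf.intervalIntegrable a p)
    (hf.intervalIntegrable p b), ← intervalIntegral.integral_add_adjacent_intervals
    (hf.intervalIntegrable p q) (hf.intervalIntegrable q b), h1, h2]
  ring

lemma integral_scaled_tent {g : ℝ → ℝ} {ε : ℝ} (hε : 0 < ε) (a p q : ℝ) :
    ∫ t in (a + ε * p)..(a + ε * q), tent ((t - a) / ε) / ε * g t =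
      ∫ s in p..q, tent s * g (a + ε * s) := by
  have h := intervalIntegral.integral_comp_mul_add (a := p) (b := q)
    (fun t => tent ((t - a) / ε) / ε * g t) hε.ne' a
  rw [add_comm a (ε * p), add_comm a (ε * q)]
  have h2 : ∫ t in ε * p + a..ε * q + a, tent ((t - a) / ε) / ε * g t =
      ε * ∫ s in p..q, tent ((ε * s + a - a) / ε) / ε * g (ε * s + a) := by
    rw [h, smul_eq_mul, ← mul_assoc, mul_inv_cancel₀ hε.ne', one_mul]
  rw [h2, ← intervalIntegral.integral_const_mul]
  refine intervalIntegral.integral_congr fun s _ => ?_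
  simp only [add_sub_cancel_right]
  rw [mul_div_cancel_left₀ _ hε.ne', add_comm (ε * s)]
  field_simp

lemma tendsto_integral_tent_comp {g : ℝ → ℝ} (hg : Continuous g) (a p q : ℝ) :
    Filter.Tendsto (fun ε : ℝ => ∫ s in p..q, tent s * g (a + ε * s)) (nhdsWithin 0 (Set.Ioi 0))
      (nhds ((∫ s in p..q, tent s) * g a)) := by
  have hc : Continuous fun ε : ℝ => ∫ s in p..q, tent s * g (a + ε * s) := by
    refine intervalIntegral.continuous_parametric_intervalIntegral_of_continuous' ?_ p q
    have := continuous_tent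
    simp only [Function.uncurry_def]
    fun_prop
  have h := (hc.tendsto 0).mono_left (nhdsWithin_le_nhds (s := Set.Ioi 0))
  simpa using h

/-- The rescaled tent is an approximate unit mass at the interior point `a` of the edge. -/
lemma tendsto_integral_scaled_tent {g : ℝ → ℝ} (hg : Continuous g) {a : ℝ} (ha : 0 < a)
    (ha' : a < 1 / 2) :
    Filter.Tendsto (fun ε : ℝ => ∫ t in (0 : ℝ)..(1 / 2), tent ((t - a) / ε) / ε * g t)
      (nhdsWithin 0 (Set.Ioi 0)) (nhds (g a)) := by
  have h := tendsto_integral_tent_comp hg a (-1) 1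
  rw [integral_tent, one_mul] at h
  refine h.congr' ?_
  have h1 : ∀ᶠ ε : ℝ in nhdsWithin 0 (Set.Ioi 0), ε < min a (1 / 2 - a) :=
    nhdsWithin_le_nhds (Iio_mem_nhds (lt_min ha (by linarith)))
  filter_upwards [h1, self_mem_nhdsWithin] with ε hε hε0
  have hε0 : 0 < ε := hε0
  have hε1 := hε.trans_le (min_le_left _ _)
  have hε2 := hε.trans_le (min_le_right _ _)
  rw [← integral_scaled_tent hε0]
  symm
  have := continuous_tent
  refine integral_eq_of_eq_zero_off (by fun_prop) (by linarith) (by linarith)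
    (fun t _ ht => ?_) fun t ht => ?_
  · rw [(tent_of_le_neg_one ((div_le_iff₀ hε0).2 (by linarith))).1]
    simp
  · rw [(tent_of_one_le ((le_div_iff₀ hε0).2 (by linarith))).1]
    simp

/-- Only the right half of the tent lies on the arm, so each arm sees mass `1/2` at the vertex. -/
lemma tendsto_integral_scaled_tent_zero {g : ℝ → ℝ} (hg : Continuous g) :
    Filter.Tendsto (fun ε : ℝ => ∫ t in (0 : ℝ)..(1 / 2), tent (t / ε) / ε * g t)
      (nhdsWithin 0 (Set.Ioi 0)) (nhds (g 0 / 2)) := by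
  have h := tendsto_integral_tent_comp hg 0 0 1
  rw [integral_tent_right, one_div_mul_eq_div] at h
  refine h.congr' ?_
  have h1 : ∀ᶠ ε : ℝ in nhdsWithin 0 (Set.Ioi 0), ε < 1 / 2 :=
    nhdsWithin_le_nhds (Iio_mem_nhds (by norm_num))
  filter_upwards [h1, self_mem_nhdsWithin] with ε hε hε0
  have hε0 : 0 < ε := hε0
  rw [← integral_scaled_tent hε0]
  symm
  have := continuous_tent
  simp only [sub_zero]
  refine integral_eq_of_eq_zero_off (by fun_prop) (by linarith) (by linarith)
    (fun t h1 h2 => by linarith) fun t ht => ?_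
  rw [(tent_of_one_le ((le_div_iff₀ hε0).2 (by linarith))).1]
  simp

/-- The mollified kink converges to the kink `(-t)⁺`, with equality as soon as `ε < |t|` when `t ≠
0`. -/
lemma tendsto_scaled_tentPrim₂ (t : ℝ) :
    Filter.Tendsto (fun ε : ℝ => ε * tentPrim₂ (t / ε)) (nhdsWithin 0 (Set.Ioi 0))
      (nhds (max (-t) 0)) := by
  have hpos : ∀ᶠ ε : ℝ in nhdsWithin 0 (Set.Ioi 0), 0 < ε := self_mem_nhdsWithin
  have hid : Filter.Tendsto (fun ε : ℝ => ε) (nhdsWithin 0 (Set.Ioi 0)) (nhds 0) :=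
    nhdsWithin_le_nhds
  rcases lt_trichotomy t 0 with ht | rfl | ht
  · rw [max_eq_left (by linarith)]
    refine tendsto_const_nhds.congr' ?_
    filter_upwards [hpos, hid (Iio_mem_nhds (neg_pos.2 ht))] with ε hε hε1
    have hε1 : ε < -t := hε1
    rw [(tent_of_le_neg_one ((div_le_iff₀ hε).2 (by linarith))).2.2]
    field_simp
  · simpa using hid.mul_const (tentPrim₂ 0)
  · rw [max_eq_right (by linarith)]
    refine tendsto_const_nhds.congr' ?_
    filter_upwards [hpos, hid (Iio_mem_nhds ht)] with ε hε hε1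
    have hε1 : ε < t := hε1
    rw [(tent_of_one_le ((le_div_iff₀ hε).2 (by linarith))).2.2, mul_zero]

/-! ### The covariance of the field -/

lemma sq_covariance_le {Ω : Type*} [MeasurableSpace Ω] {μ : Measure Ω} [IsProbabilityMeasure μ]
    {Y Z : Ω → ℝ} (hY : MemLp Y 2 μ) (hZ : MemLp Z 2 μ) :
    cov[Y, Z; μ] ^ 2 ≤ Var[Y; μ] * Var[Z; μ] := by
  have h : ∀ s : ℝ, 0 ≤ Var[Y; μ] * (s * s) + 2 * cov[Y, Z; μ] * s + Var[Z; μ] := fun s => by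
    have h1 := variance_add (hY.const_smul s) hZ
    rw [variance_smul, covariance_smul_left] at h1
    have h2 := variance_nonneg (s • Y + Z) μ
    rw [h1] at h2
    linarith
  have := discrim_le_zero h
  rw [discrim] at this
  nlinarith

section Field

variable {Ω : Type*} [MeasurableSpace Ω] {μ : Measure Ω} [IsProbabilityMeasure μ]
  {g : Cable d → Cable d → ℝ≥0∞} {Φ : Cable d → Ω → ℝ}

omit [IsProbabilityMeasure μ] in
lemma IsGaussianField.memLp (hΦ : IsGaussianField g μ Φ) (z : Cable d) : MemLp (Φ z) 2 μ :=
  (hΦ.gaussian.hasGaussianLaw_eval z).memLp_two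

lemma IsGaussianField.covariance_eq (hΦ : IsGaussianField g μ Φ) (z y : Cable d) :
    cov[Φ z, Φ y; μ] = ∫ ω, Φ z ω * Φ y ω ∂μ := by
  rw [covariance_eq_sub (hΦ.memLp z) (hΦ.memLp y), hΦ.centered, zero_mul, sub_zero]
  rfl

/-- Equating a real covariance with an extended nonnegative number forces the Green function to be
finite and the covariance to be nonnegative. -/
lemma IsGaussianField.green_eq (hΦ : IsGaussianField g μ Φ) (z y : Cable d) :
    g z y = ENNReal.ofReal cov[Φ z, Φ y; μ] ∧ 0 ≤ cov[Φ z, Φ y; μ] := by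
  have h := hΦ.covariance z y
  rw [← hΦ.covariance_eq] at h
  have h0 : 0 ≤ cov[Φ z, Φ y; μ] := by
    have : (0 : EReal) ≤ ((cov[Φ z, Φ y; μ] : ℝ) : EReal) := by
      rw [h]; exact EReal.coe_ennreal_nonneg _
    exact_mod_cast this
  refine ⟨?_, h0⟩
  rw [← EReal.coe_ennreal_eq_coe_ennreal_iff, ← h, EReal.coe_ennreal_ofReal, max_eq_left h0]

/-- Sample continuity yields `L²` continuity: the characteristic function of the increment at `1` is
`exp(-Var/2)` and tends to `1` by dominated convergence. Taking logarithms of the norms concludes.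
-/
lemma IsGaussianField.tendsto_variance_sub (hΦ : IsGaussianField g μ Φ) (y : Cable d) :
    Filter.Tendsto (fun y' => Var[fun ω => Φ y' ω - Φ y ω; μ]) (nhds y) (nhds 0) := by
  have hchar : ∀ y', charFun (μ.map fun ω => Φ y' ω - Φ y ω) 1 =
      Complex.exp ((-(Var[fun ω => Φ y' ω - Φ y ω; μ] / 2) : ℝ) : ℂ) := fun y' => by
    have hG : HasGaussianLaw (fun ω => Φ y' ω - Φ y ω) μ := hΦ.gaussian.hasGaussianLaw_fun_sub
    rw [hG.charFun_map_eq]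
    have hmean : ∫ ω, (Φ y' ω - Φ y ω) ∂μ = 0 := by
      rw [integral_sub ((hΦ.memLp y').integrable one_le_two)
        ((hΦ.memLp y).integrable one_le_two), hΦ.centered, hΦ.centered, sub_zero]
    simp [hmean]
  have hlim : Filter.Tendsto (fun y' => charFun (μ.map fun ω => Φ y' ω - Φ y ω) 1) (nhds y)
      (nhds 1) := by
    have h : Filter.Tendsto (fun y' => ∫ ω, Complex.exp (((Φ y' ω - Φ y ω : ℝ) : ℂ) * Complex.I) ∂μ)
        (nhds y) (nhds (∫ _, (1 : ℂ) ∂μ)) := by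
      refine tendsto_integral_filter_of_dominated_convergence (fun _ => 1)
        (Filter.Eventually.of_forall fun y' => ?_) (Filter.Eventually.of_forall fun y' => ?_)
        (integrable_const _) (ae_of_all _ fun ω => ?_)
      · exact (Complex.measurable_exp.comp ((Complex.measurable_ofReal.comp
          ((hΦ.measurable y').sub (hΦ.measurable y))).mul_const _)).aestronglyMeasurable
      · exact ae_of_all _ fun ω => (Complex.norm_exp_ofReal_mul_I _).le
      · have hc : Continuous fun y' => Complex.exp (((Φ y' ω - Φ y ω : ℝ) : ℂ) * Complex.I) := by
          have := hΦ.continuous ω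
          fun_prop
        simpa using hc.tendsto y
    simp only [integral_const, probReal_univ, one_smul] at h
    refine h.congr fun y' => ?_
    have hm : Measurable fun ω => Φ y' ω - Φ y ω := (hΦ.measurable y').sub (hΦ.measurable y)
    rw [charFun_apply, integral_map hm.aemeasurable]
    · simp
    · exact (by fun_prop : Continuous fun r : ℝ =>
        Complex.exp ((inner ℝ r 1 : ℝ) * Complex.I)).aestronglyMeasurable
  simp_rw [hchar] at hlim
  have h1 := hlim.norm
  simp only [Complex.norm_exp_ofReal, norm_one] at h1
  have h2 := (Real.continuousAt_log one_ne_zero).tendsto.comp h1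
  simp only [Function.comp_def, Real.log_exp, Real.log_one] at h2
  have h3 := h2.const_mul (-2)
  simp only [mul_zero] at h3
  exact h3.congr fun y' => by ring

lemma IsGaussianField.continuous_covariance (hΦ : IsGaussianField g μ Φ) (z : Cable d) :
    Continuous fun y => cov[Φ z, Φ y; μ] := by
  refine continuous_iff_continuousAt.2 fun y => ?_
  rw [ContinuousAt, tendsto_iff_norm_sub_tendsto_zero]
  have h1 : Filter.Tendsto (fun y' => √(Var[Φ z; μ] * Var[fun ω => Φ y' ω - Φ y ω; μ])) (nhds y)
      (nhds 0) := by
    have h := ((hΦ.tendsto_variance_sub y).const_mul Var[Φ z; μ]).sqrt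
    simpa using h
  refine squeeze_zero (fun _ => norm_nonneg _) (fun y' => ?_) h1
  rw [← covariance_sub_right (hΦ.memLp z) (hΦ.memLp y') (hΦ.memLp y), Real.norm_eq_abs]
  exact Real.abs_le_sqrt (sq_covariance_le (hΦ.memLp z) ((hΦ.memLp y').sub (hΦ.memLp y)))

end Field

/-! ### The covariance on a star -/

lemma integrable_lebesgue_of_star {x : Fin d → ℤ} {φ : Cable d → ℝ} (hφ : Continuous φ)
    (h0 : ∀ z, 1 ≤ dist z (vertex x) → φ z = 0) : Integrable φ (lebesgue d) := by
  have hsupp : Function.support φ ⊆ Metric.ball (vertex x) 1 := fun z hz =>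
    Metric.mem_ball.2 (not_le.1 fun h => hz (h0 z h))
  rw [← integrableOn_iff_integrable_of_support_subset hsupp, IntegrableOn, lebesgue_restrict_ball]
  refine Integrable.restrict ?_
  rw [starMeasure, integrable_finsetSum_measure]
  intro v _
  rw [integrable_map_measure hφ.aestronglyMeasurable (continuous_point _ _).aemeasurable]
  exact (hφ.comp (continuous_point x v)).integrableOn_Icc

section Potential

variable {W : Type*} [MeasurableSpace W] {P : Cable d → Measure W}
  {X : ℝ≥0 → W → Cable d} {L : ℝ≥0 → Cable d → W → ℝ≥0}
  {Ω : Type*} [MeasurableSpace Ω] {μ : Measure Ω} [IsProbabilityMeasure μ] {Φ : Cable d → Ω → ℝ}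

/-- The covariance is the Green function, and it is finite and continuous. Continuous functions
supported in the star are therefore integrable against it, as the potential identity requires. -/
lemma integral_second_mul_covariance (hX : IsCableDiffusion P X L)
    (hΦ : IsGaussianField (green P L) μ Φ) {f u : Cable d → ℝ} (hfu : IsKirchhoffTest f u)
    (hcu : HasCompactSupport u) {x : Fin d → ℤ} (hf : ∀ z, 1 ≤ dist z (vertex x) → f z = 0)
    (hu : ∀ z, 1 ≤ dist z (vertex x) → u z = 0) (z : Cable d) :
    ∑ v : V0 d, ∫ t in (0 : ℝ)..(1 / 2), u (point x v t) * cov[Φ z, Φ (point x v t); μ] =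
      -2 * f z := by
  have hC := hΦ.continuous_covariance z
  have hg : green P L z = fun y => ENNReal.ofReal cov[Φ z, Φ y; μ] :=
    funext fun y => (hΦ.green_eq z y).1
  have hgm : Measurable fun y => ENNReal.ofReal cov[Φ z, Φ y; μ] := hC.measurable.ennreal_ofReal
  have hint : ∀ φ : Cable d → ℝ, Continuous φ → (∀ z, 1 ≤ dist z (vertex x) → φ z = 0) →
      Integrable φ ((lebesgue d).withDensity (green P L z)) := fun φ hφ h0 => by
    rw [hg, integrable_withDensity_iff_integrable_smul' hgm
      (ae_of_all _ fun _ => ENNReal.ofReal_lt_top)]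
    refine (integrable_lebesgue_of_star (x := x) (φ := fun y => cov[Φ z, Φ y; μ] * φ y)
      (hC.mul hφ) fun y hy => by rw [h0 y hy, mul_zero]).congr (ae_of_all _ fun y => ?_)
    simp only [smul_eq_mul]
    rw [ENNReal.toReal_ofReal (hΦ.green_eq z y).2]
  have h1 := hX.integral_withDensity_green hfu z hcu (hint f hfu.continuous hf)
    (hint u hfu.continuous_second hu)
  rw [hg, integral_withDensity_eq_integral_toReal_smul hgm
    (ae_of_all _ fun _ => ENNReal.ofReal_lt_top)] at h1
  rw [← integral_lebesgue_of_star (x := x) (φ := fun y => u y * cov[Φ z, Φ y; μ])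
    (hfu.continuous_second.mul hC) fun y hy => by rw [hu y hy, zero_mul], ← h1]
  refine integral_congr_ae (ae_of_all _ fun y => ?_)
  simp only [smul_eq_mul]
  rw [ENNReal.toReal_ofReal (hΦ.green_eq z y).2, mul_comm]

/-- The covariance of the field, tested against a function on the star around `x` that is linear on
every arm off the distances `0`, `h` and `1/4` from `x`. The slope on the arm `v` jumps by `α v`
at `h` and by `β v` at `1/4`. -/
lemma covariance_star [NeZero d] (hX : IsCableDiffusion P X L)
    (hΦ : IsGaussianField (green P L) μ Φ) (x : Fin d → ℤ) {h : ℝ} (hh : 0 < h) (hh' : h ≤ 1 / 4)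
    {α β : V0 d → ℝ} {c : ℝ} (hc : ∀ v, α v * h + β v * (1 / 4) = c) (w : V0 d) {s : ℝ}
    (hs : s ∈ Set.Icc (0 : ℝ) (1 / 2)) :
    ∑ v, (α v * cov[Φ (point x w s), Φ (point x v h); μ] +
        β v * cov[Φ (point x w s), Φ (point x v (1 / 4)); μ]) -
        (∑ v, (α v + β v)) * cov[Φ (point x w s), Φ (vertex x); μ] =
      -2 * (α w * max (h - s) 0 + β w * max (1 / 4 - s) 0) := by
  set z := point x w s
  set N : ℝ := (Fintype.card (V0 d) : ℝ)
  have hN : N ≠ 0 := Nat.cast_ne_zero.2 Fintype.card_ne_zero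
  set κ : ℝ := ∑ v, (α v + β v)
  -- The weight of a tent at the vertex. Each arm gets slope `-c₀/2` from it and `-(α v + β v)` from
  -- the other two tents, and this choice makes the outgoing slopes sum to zero.
  set c₀ : ℝ := -2 * κ / N
  have hC : ∀ v, Continuous fun t => cov[Φ z, Φ (point x v t); μ] := fun v =>
    (hΦ.continuous_covariance z).comp (continuous_point x v)
  let F : ℝ → V0 d → ℝ → ℝ := fun ε v t => c₀ * (ε * tentPrim₂ (t / ε)) +
    α v * (ε * tentPrim₂ ((t - h) / ε)) + β v * (ε * tentPrim₂ ((t - 1 / 4) / ε))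
  let F' : ℝ → V0 d → ℝ → ℝ := fun ε v t => c₀ * tentPrim (t / ε) +
    α v * tentPrim ((t - h) / ε) + β v * tentPrim ((t - 1 / 4) / ε)
  let U : ℝ → V0 d → ℝ → ℝ := fun ε v t => c₀ * (tent (t / ε) / ε) +
    α v * (tent ((t - h) / ε) / ε) + β v * (tent ((t - 1 / 4) / ε) / ε)
  have hsmall : ∀ᶠ ε : ℝ in nhdsWithin 0 (Set.Ioi 0), 0 < ε ∧ ε < h ∧ ε < 1 / 8 := by
    filter_upwards [self_mem_nhdsWithin, nhdsWithin_le_nhds (Iio_mem_nhds hh),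
      nhdsWithin_le_nhds (Iio_mem_nhds (show (0 : ℝ) < 1 / 8 by norm_num))] with ε h1 h2 h3
    exact ⟨h1, h2, h3⟩
  have hder : ∀ ε : ℝ, 0 < ε → ∀ a t : ℝ,
      HasDerivAt (fun t => ε * tentPrim₂ ((t - a) / ε)) (tentPrim ((t - a) / ε)) t ∧
      HasDerivAt (fun t => tentPrim ((t - a) / ε)) (tent ((t - a) / ε) / ε) t := by
    intro ε hε a t
    have h1 : HasDerivAt (fun t => (t - a) / ε) (1 / ε) t :=
      ((hasDerivAt_id t).sub_const a).div_const ε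
    constructor
    · have := ((hasDerivAt_tentPrim₂ ((t - a) / ε)).comp t h1).const_mul ε
      convert! this using 1
      field_simp
    · have := (hasDerivAt_tentPrim ((t - a) / ε)).comp t h1
      convert! this using 1
      ring
  have hident : ∀ᶠ ε : ℝ in nhdsWithin 0 (Set.Ioi 0),
      ∑ v, ∫ t in (0 : ℝ)..(1 / 2), U ε v t * cov[Φ z, Φ (point x v t); μ] = -2 * F ε w s := by
    filter_upwards [hsmall] with ε ⟨hε, hεh, hε8⟩
    have hlow : ∀ a : ℝ, ε < a → (0 - a) / ε ≤ -1 := fun a ha =>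
      (div_le_iff₀ hε).2 (by linarith)
    have hhigh : ∀ a : ℝ, a ≤ 1 / 4 → ∀ t : ℝ, 3 / 8 ≤ t → 1 ≤ (t - a) / ε := fun a ha t ht =>
      (le_div_iff₀ hε).2 (by linarith)
    have hhigh0 : ∀ t : ℝ, 3 / 8 ≤ t → 1 ≤ t / ε := fun t ht =>
      (le_div_iff₀ hε).2 (by linarith)
    have h1 : ∀ v t, HasDerivAt (F ε v) (F' ε v t) t := fun v t => by
      have h0 := (hder ε hε 0 t).1
      simp only [sub_zero] at h0
      exact ((h0.const_mul c₀).add ((hder ε hε h t).1.const_mul (α v))).add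
        ((hder ε hε (1 / 4) t).1.const_mul (β v))
    have h2 : ∀ v t, HasDerivAt (F' ε v) (U ε v t) t := fun v t => by
      have h0 := (hder ε hε 0 t).2
      simp only [sub_zero] at h0
      exact ((h0.const_mul c₀).add ((hder ε hε h t).2.const_mul (α v))).add
        ((hder ε hε (1 / 4) t).2.const_mul (β v))
    have h3 : ∀ v, Continuous (U ε v) := fun v => by
      have := continuous_tent
      fun_prop
    -- For small `ε` the tents around `h` and `1/4` do not reach the vertex, so the value there is
    -- `α v * h + β v / 4 = c` plus a term common to all arms.
    have hF0 : ∀ v, F ε v 0 = c₀ * (ε * tentPrim₂ 0) + c := fun v => by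
      simp only [F, (tent_of_le_neg_one (hlow h hεh)).2.2,
        (tent_of_le_neg_one (hlow (1 / 4) (by linarith))).2.2, zero_div, ← hc v]
      field_simp
      ring
    have hU0 : ∀ v, U ε v 0 = c₀ * (tent 0 / ε) := fun v => by
      simp only [U, (tent_of_le_neg_one (hlow h hεh)).1,
        (tent_of_le_neg_one (hlow (1 / 4) (by linarith))).1, zero_div]
      ring
    have hF'0 : ∀ v, F' ε v 0 = -c₀ / 2 - (α v + β v) := fun v => by
      simp only [F', (tent_of_le_neg_one (hlow h hεh)).2.1,
        (tent_of_le_neg_one (hlow (1 / 4) (by linarith))).2.1, zero_div, tentPrim_zero]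
      ring
    have hFz : ∀ v t, 3 / 8 ≤ t → F ε v t = 0 := fun v t ht => by
      simp only [F, (tent_of_one_le (hhigh h hh' t ht)).2.2, (tent_of_one_le (hhigh0 t ht)).2.2,
        (tent_of_one_le (hhigh (1 / 4) le_rfl t ht)).2.2]
      ring
    have hF'z : ∀ v t, 3 / 8 ≤ t → F' ε v t = 0 := fun v t ht => by
      simp only [F', (tent_of_one_le (hhigh h hh' t ht)).2.1, (tent_of_one_le (hhigh0 t ht)).2.1,
        (tent_of_one_le (hhigh (1 / 4) le_rfl t ht)).2.1]
      ring
    have hUz : ∀ v t, 3 / 8 ≤ t → U ε v t = 0 := fun v t ht => by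
      simp only [U, (tent_of_one_le (hhigh h hh' t ht)).1, (tent_of_one_le (hhigh0 t ht)).1,
        (tent_of_one_le (hhigh (1 / 4) le_rfl t ht)).1]
      ring
    have hsum : ∑ v, F' ε v 0 = 0 := by
      simp_rw [hF'0]
      rw [Finset.sum_sub_distrib, Finset.sum_const, Finset.card_univ, nsmul_eq_mul]
      change N * (-c₀ / 2) - κ = 0
      simp only [c₀]
      field_simp
      ring
    have htest := isKirchhoffTest_starExtend (x := x) h1 h2 h3 hF0 hU0 hFz hF'z hUz hsum
    have hpot := integral_second_mul_covariance hX hΦ htest hasCompactSupport_starExtend (x := x)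
      (fun y hy => starExtend_of_dist (by linarith)) (fun y hy => starExtend_of_dist (by linarith)) z
    rw [starExtend_point hF0 hFz w hs] at hpot
    rw [← hpot]
    refine Finset.sum_congr rfl fun v _ => intervalIntegral.integral_congr fun t ht => ?_
    rw [Set.uIcc_of_le (by norm_num)] at ht
    rw [starExtend_point hU0 hUz v ht]
  -- The vertex tent leaves no trace in the limit, since `(-s)⁺ = 0` for `s ≥ 0`.
  have hright : Filter.Tendsto (fun ε => -2 * F ε w s) (nhdsWithin 0 (Set.Ioi 0))
      (nhds (-2 * (α w * max (h - s) 0 + β w * max (1 / 4 - s) 0))) := by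
    have h0 := (tendsto_scaled_tentPrim₂ s).const_mul c₀
    rw [max_eq_right (by linarith [hs.1]), mul_zero] at h0
    have h1 := (tendsto_scaled_tentPrim₂ (s - h)).const_mul (α w)
    have h2 := (tendsto_scaled_tentPrim₂ (s - 1 / 4)).const_mul (β w)
    rw [neg_sub] at h1 h2
    have := ((h0.add h1).add h2).const_mul (-2)
    rwa [zero_add] at this
  have hleft : Filter.Tendsto (fun ε => ∑ v, ∫ t in (0 : ℝ)..(1 / 2),
      U ε v t * cov[Φ z, Φ (point x v t); μ]) (nhdsWithin 0 (Set.Ioi 0))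
      (nhds (∑ v, (c₀ * (cov[Φ z, Φ (vertex x); μ] / 2) +
        α v * cov[Φ z, Φ (point x v h); μ] + β v * cov[Φ z, Φ (point x v (1 / 4)); μ]))) := by
    refine tendsto_finsetSum _ fun v _ => ?_
    have h0 := (tendsto_integral_scaled_tent_zero (hC v)).const_mul c₀
    rw [point_zero] at h0
    have h1 := (tendsto_integral_scaled_tent (hC v) hh (by linarith)).const_mul (α v)
    have h2 := (tendsto_integral_scaled_tent (hC v) (show (0 : ℝ) < 1 / 4 by norm_num)
      (by norm_num)).const_mul (β v)
    refine ((h0.add h1).add h2).congr fun ε => ?_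
    have := continuous_tent
    have hCv := hC v
    simp_rw [← intervalIntegral.integral_const_mul]
    rw [← intervalIntegral.integral_add, ← intervalIntegral.integral_add]
    · refine intervalIntegral.integral_congr fun t _ => ?_
      simp only [U]
      ring
    all_goals exact Continuous.intervalIntegrable (by fun_prop) _ _
  have hfin := tendsto_nhds_unique (hleft.congr' hident) hright
  rw [← hfin]
  have hconst : ∑ _ : V0 d, c₀ * (cov[Φ z, Φ (vertex x); μ] / 2) =
      -κ * cov[Φ z, Φ (vertex x); μ] := by
    rw [Finset.sum_const, Finset.card_univ, nsmul_eq_mul]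
    change N * _ = _
    simp only [c₀]
    field_simp
  simp_rw [add_assoc, Finset.sum_add_distrib]
  rw [hconst]
  ring

end Potential

/-! ### The innovations of the field at the star -/

section Innovation

variable {W : Type*} [MeasurableSpace W] {P : Cable d → Measure W}
  {X : ℝ≥0 → W → Cable d} {L : ℝ≥0 → Cable d → W → ℝ≥0}
  {Ω : Type*} [MeasurableSpace Ω] {μ : Measure Ω} {Φ : Cable d → Ω → ℝ}

/-- The field at `x` minus its average over the boundary of the star, and the field at distance `h`
from `x` minus its linear interpolation between `x` and the boundary of the star. -/
def innovation (Φ : Cable d → Ω → ℝ) (x : Fin d → ℤ) (h : ℝ) : Option (V0 d) → Ω → ℝ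
  | none => fun ω => Φ (vertex x) ω -
      (Fintype.card (V0 d) : ℝ)⁻¹ * ∑ v, Φ (point x v (1 / 4)) ω
  | some v => fun ω => Φ (point x v h) ω -
      (4 * h * Φ (point x v (1 / 4)) ω + (1 - 4 * h) * Φ (vertex x) ω)

lemma measurable_innovation (hΦ : ∀ z, Measurable (Φ z)) (x : Fin d → ℤ) (h : ℝ)
    (o : Option (V0 d)) : Measurable (innovation Φ x h o) := by
  cases o with
  | none => exact (hΦ _).sub ((Finset.measurable_sum _ fun v _ => hΦ _).const_mul _)
  | some v => exact (hΦ _).sub (((hΦ _).const_mul _).add ((hΦ _).const_mul _))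

/-- The boundary values are included so that joint Gaussianity turns uncorrelatedness into
independence of the innovations from the boundary. -/
lemma isGaussianProcess_innovation (hΦ : IsGaussianProcess Φ μ) (x : Fin d → ℤ) (h : ℝ) :
    IsGaussianProcess (Sum.elim (innovation Φ x h) fun v : V0 d => Φ (point x v (1 / 4))) μ := by
  classical
  refine hΦ.of_isGaussianProcess fun s => ?_
  rcases s with (_ | v) | v
  · refine ⟨insert (vertex x) (Finset.univ.image fun v : V0 d => point x v (1 / 4)),
      { toFun := fun y => y ⟨vertex x, by simp⟩ -
          (Fintype.card (V0 d) : ℝ)⁻¹ * ∑ v : V0 d, y ⟨point x v (1 / 4), by simp⟩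
        map_add' := fun y y' => by
          simp only [Pi.add_apply, Finset.sum_add_distrib]
          ring
        map_smul' := fun r y => by
          simp only [Pi.smul_apply, smul_eq_mul, ← Finset.mul_sum, RingHom.id_apply]
          ring
        cont := by fun_prop }, fun ω => rfl⟩
  · refine ⟨{point x v h, point x v (1 / 4), vertex x},
      ContinuousLinearMap.proj (⟨point x v h, by simp⟩ :
        ({point x v h, point x v (1 / 4), vertex x} : Finset (Cable d))) -
      ((4 * h) • ContinuousLinearMap.proj (⟨point x v (1 / 4), by simp⟩ :
        ({point x v h, point x v (1 / 4), vertex x} : Finset (Cable d))) +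
      (1 - 4 * h) • ContinuousLinearMap.proj (⟨vertex x, by simp⟩ :
        ({point x v h, point x v (1 / 4), vertex x} : Finset (Cable d)))), fun ω => ?_⟩
    simp [innovation]
  · exact ⟨{point x v (1 / 4)}, ContinuousLinearMap.proj (⟨point x v (1 / 4), by simp⟩ :
      ({point x v (1 / 4)} : Finset (Cable d))), fun ω => by simp⟩

variable [IsProbabilityMeasure μ]

omit [IsProbabilityMeasure μ] in
lemma memLp_innovation (hΦ : IsGaussianProcess Φ μ) (x : Fin d → ℤ) (h : ℝ) (o : Option (V0 d)) :
    MemLp (innovation Φ x h o) 2 μ :=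
  ((isGaussianProcess_innovation hΦ x h).hasGaussianLaw_eval (Sum.inl o)).memLp_two

/-- Covariances with the innovations. -/
lemma covariance_innovation_right {Y : Ω → ℝ} (hY : MemLp Y 2 μ) (hΦ : ∀ z, MemLp (Φ z) 2 μ)
    (x : Fin d → ℤ) (h : ℝ) :
    cov[Y, innovation Φ x h none; μ] = cov[Y, Φ (vertex x); μ] -
      (Fintype.card (V0 d) : ℝ)⁻¹ * ∑ v, cov[Y, Φ (point x v (1 / 4)); μ] ∧
    ∀ v, cov[Y, innovation Φ x h (some v); μ] = cov[Y, Φ (point x v h); μ] -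
      (4 * h * cov[Y, Φ (point x v (1 / 4)); μ] + (1 - 4 * h) * cov[Y, Φ (vertex x); μ]) := by
  constructor
  · simp only [innovation]
    have hsum : MemLp (fun ω => ∑ v : V0 d, Φ (point x v (1 / 4)) ω) 2 μ :=
      memLp_finsetSum _ fun v _ => hΦ _
    rw [covariance_fun_sub_right hY (hΦ _) (hsum.const_mul _), covariance_const_mul_right,
      covariance_fun_sum_right (fun v => hΦ _) hY]
  · intro v
    simp only [innovation]
    have hsum : MemLp (fun ω => 4 * h * Φ (point x v (1 / 4)) ω + (1 - 4 * h) * Φ (vertex x) ω) 2 μ :=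
      ((hΦ _).const_mul _).add ((hΦ _).const_mul _)
    rw [covariance_fun_sub_right hY (hΦ _) hsum,
      show (fun ω => 4 * h * Φ (point x v (1 / 4)) ω + (1 - 4 * h) * Φ (vertex x) ω) =
        (4 * h) • Φ (point x v (1 / 4)) + (1 - 4 * h) • Φ (vertex x) from rfl,
      covariance_add_right hY ((hΦ _).const_smul _) ((hΦ _).const_smul _),
      covariance_smul_right, covariance_smul_right]

variable [NeZero d]

lemma covariance_point_innovation_none (hX : IsCableDiffusion P X L)
    (hΦ : IsGaussianField (green P L) μ Φ) (x : Fin d → ℤ) (h : ℝ) (w : V0 d) {s : ℝ}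
    (hs : s ∈ Set.Icc (0 : ℝ) (1 / 2)) :
    cov[Φ (point x w s), innovation Φ x h none; μ] =
      2 * max (1 / 4 - s) 0 / Fintype.card (V0 d) := by
  have hN : (Fintype.card (V0 d) : ℝ) ≠ 0 := Nat.cast_ne_zero.2 Fintype.card_ne_zero
  -- The test function is `(1/4 - s)⁺` on every arm, harmonic inside the star except at `x`.
  have key := covariance_star hX hΦ x (h := 1 / 4) (α := fun _ => 0) (β := fun _ => 1)
    (c := 1 / 4) (by norm_num) le_rfl (fun _ => by ring) w hs
  rw [(covariance_innovation_right (hΦ.memLp _) hΦ.memLp x h).1]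
  simp only [zero_mul, one_mul, zero_add, Finset.sum_const, Finset.card_univ, nsmul_eq_mul,
    mul_one] at key
  set A := cov[Φ (point x w s), Φ (vertex x); μ]
  set S := ∑ v, cov[Φ (point x w s), Φ (point x v (1 / 4)); μ]
  have hA : A = (S + 2 * max (1 / 4 - s) 0) / Fintype.card (V0 d) := by
    rw [eq_div_iff hN]
    linarith
  rw [hA]
  ring

lemma covariance_point_innovation_some (hX : IsCableDiffusion P X L)
    (hΦ : IsGaussianField (green P L) μ Φ) (x : Fin d → ℤ) {h : ℝ} (hh : 0 < h) (hh' : h ≤ 1 / 4)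
    (v w : V0 d) {s : ℝ} (hs : s ∈ Set.Icc (0 : ℝ) (1 / 2)) :
    cov[Φ (point x w s), innovation Φ x h (some v); μ] =
      if w = v then 2 * (4 * h * max (1 / 4 - s) 0 - max (h - s) 0) else 0 := by
  -- The test function lives on the arm `v` alone: it vanishes at `x` and from `1/4` on, and is
  -- linear up to and after its peak at `h`. Its slope jumps reproduce the coefficients of the
  -- innovation.
  have key := covariance_star hX hΦ x (h := h) (α := fun u => if u = v then -1 else 0)
    (β := fun u => if u = v then 4 * h else 0) (c := 0) hh hh'
    (fun u => by split_ifs <;> ring) w hs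
  rw [(covariance_innovation_right (hΦ.memLp _) hΦ.memLp x h).2]
  simp only [ite_mul, zero_mul, Finset.sum_add_distrib, Finset.sum_ite_eq', Finset.mem_univ,
    if_true] at key
  split_ifs at key ⊢ with hwv
  · linarith
  · linarith

lemma covariance_vertex_innovation_some (hX : IsCableDiffusion P X L)
    (hΦ : IsGaussianField (green P L) μ Φ) (x : Fin d → ℤ) {h : ℝ} (hh : 0 < h) (hh' : h ≤ 1 / 4)
    (v : V0 d) : cov[Φ (vertex x), innovation Φ x h (some v); μ] = 0 := by
  rw [← point_zero x v, covariance_point_innovation_some hX hΦ x hh hh' v v zero_mem_Icc_half,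
    if_pos rfl, max_eq_left (by norm_num), max_eq_left (by linarith)]
  ring

lemma covariance_boundary_innovation (hX : IsCableDiffusion P X L)
    (hΦ : IsGaussianField (green P L) μ Φ) (x : Fin d → ℤ) {h : ℝ} (hh : 0 < h) (hh' : h ≤ 1 / 4)
    (o : Option (V0 d)) (w : V0 d) :
    cov[Φ (point x w (1 / 4)), innovation Φ x h o; μ] = 0 := by
  cases o with
  | none =>
    rw [covariance_point_innovation_none hX hΦ x h w quarter_mem]
    simp
  | some v =>
    rw [covariance_point_innovation_some hX hΦ x hh hh' v w quarter_mem,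
      max_eq_right (by norm_num), max_eq_right (by linarith)]
    simp

lemma variance_innovation_none (hX : IsCableDiffusion P X L)
    (hΦ : IsGaussianField (green P L) μ Φ) (x : Fin d → ℤ) {h : ℝ} (hh : 0 < h)
    (hh' : h ≤ 1 / 4) :
    Var[innovation Φ x h none; μ] = 1 / (2 * Fintype.card (V0 d)) := by
  have hm := memLp_innovation hΦ.gaussian x h none
  rw [← covariance_self hm.aestronglyMeasurable.aemeasurable,
    (covariance_innovation_right hm hΦ.memLp x h).1]
  simp_rw [covariance_comm (innovation Φ x h none)]
  simp_rw [covariance_boundary_innovation hX hΦ x hh hh' none]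
  rw [← point_zero x (posDir 0), covariance_point_innovation_none hX hΦ x h _ zero_mem_Icc_half,
    max_eq_left (by norm_num)]
  have hN : (Fintype.card (V0 d) : ℝ) ≠ 0 := Nat.cast_ne_zero.2 Fintype.card_ne_zero
  simp only [Finset.sum_const_zero]
  field_simp
  norm_num

lemma covariance_innovation_some (hX : IsCableDiffusion P X L)
    (hΦ : IsGaussianField (green P L) μ Φ) (x : Fin d → ℤ) {h : ℝ} (hh : 0 < h)
    (hh' : h ≤ 1 / 4) (v w : V0 d) :
    cov[innovation Φ x h (some v), innovation Φ x h (some w); μ] =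
      if w = v then 2 * h * (1 - 4 * h) else 0 := by
  have hm := memLp_innovation hΦ.gaussian x h (some v)
  rw [(covariance_innovation_right hm hΦ.memLp x h).2,
    covariance_comm _ (Φ (point x w h)), covariance_comm _ (Φ (point x w (1 / 4))),
    covariance_comm _ (Φ (vertex x)), covariance_boundary_innovation hX hΦ x hh hh',
    covariance_vertex_innovation_some hX hΦ x hh hh',
    covariance_point_innovation_some hX hΦ x hh hh' v w ⟨hh.le, by linarith⟩, sub_self, max_self,
    max_eq_left (by linarith)]
  split_ifs <;> ring

lemma covariance_innovation_none_some (hX : IsCableDiffusion P X L)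
    (hΦ : IsGaussianField (green P L) μ Φ) (x : Fin d → ℤ) {h : ℝ} (hh : 0 < h)
    (hh' : h ≤ 1 / 4) (v : V0 d) :
    cov[innovation Φ x h (some v), innovation Φ x h none; μ] = 0 := by
  have hm := memLp_innovation hΦ.gaussian x h (some v)
  rw [(covariance_innovation_right hm hΦ.memLp x h).1, covariance_comm _ (Φ (vertex x)),
    covariance_vertex_innovation_some hX hΦ x hh hh']
  simp_rw [covariance_comm (innovation Φ x h (some v)),
    covariance_boundary_innovation hX hΦ x hh hh']
  simp

lemma iIndepFun_innovation (hX : IsCableDiffusion P X L)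
    (hΦ : IsGaussianField (green P L) μ Φ) (x : Fin d → ℤ) {h : ℝ} (hh : 0 < h)
    (hh' : h ≤ 1 / 4) : iIndepFun (innovation Φ x h) μ := by
  have hG : IsGaussianProcess (innovation Φ x h) μ :=
    (isGaussianProcess_innovation hΦ.gaussian x h).comp_right Sum.inl
  have hL : HasGaussianLaw (fun ω => (innovation Φ x h · ω)) μ :=
    (hG.hasGaussianLaw Finset.univ).map
      (ContinuousLinearMap.pi fun o => ContinuousLinearMap.proj
        (⟨o, Finset.mem_univ o⟩ : (Finset.univ : Finset (Option (V0 d)))))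
  refine hL.iIndepFun_of_covariance_eq_zero fun i j hij => ?_
  cases i with
  | none =>
    cases j with
    | none => exact absurd rfl hij
    | some w => rw [covariance_comm, covariance_innovation_none_some hX hΦ x hh hh']
  | some v =>
    cases j with
    | none => exact covariance_innovation_none_some hX hΦ x hh hh' v
    | some w =>
      rw [covariance_innovation_some hX hΦ x hh hh', if_neg fun h => hij (by rw [h])]

lemma indepFun_boundary_innovation (hX : IsCableDiffusion P X L)
    (hΦ : IsGaussianField (green P L) μ Φ) (x : Fin d → ℤ) {h : ℝ} (hh : 0 < h)
    (hh' : h ≤ 1 / 4) :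
    IndepFun (fun ω (v : V0 d) => Φ (point x v (1 / 4)) ω) (fun ω o => innovation Φ x h o ω) μ := by
  refine IndepFun.symm ((isGaussianProcess_innovation hΦ.gaussian x h).indepFun_of_covariance_eq_zero
    (fun o => (measurable_innovation hΦ.measurable x h o).aemeasurable)
    (fun v => (hΦ.measurable _).aemeasurable) fun o v => ?_)
  rw [covariance_comm, covariance_boundary_innovation hX hΦ x hh hh']

lemma map_innovation (hX : IsCableDiffusion P X L)
    (hΦ : IsGaussianField (green P L) μ Φ) (x : Fin d → ℤ) {h : ℝ} (hh : 0 < h)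
    (hh' : h ≤ 1 / 4) :
    μ.map (innovation Φ x h none) =
      gaussianReal 0 (1 / (2 * Fintype.card (V0 d)) : ℝ).toNNReal ∧
    ∀ v, μ.map (innovation Φ x h (some v)) = gaussianReal 0 (2 * h * (1 - 4 * h)).toNNReal := by
  have hG : ∀ o, HasGaussianLaw (innovation Φ x h o) μ := fun o =>
    (isGaussianProcess_innovation hΦ.gaussian x h).hasGaussianLaw_eval (Sum.inl o)
  have hi : ∀ z, Integrable (Φ z) μ := fun z => (hΦ.memLp z).integrable one_le_two
  constructor
  · rw [(hG none).map_eq_gaussianReal, variance_innovation_none hX hΦ x hh hh']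
    congr 1
    simp only [innovation]
    rw [integral_sub (hi _) ((integrable_finsetSum _ fun v _ => hi _).const_mul _),
      integral_const_mul, integral_finsetSum _ fun v _ => hi _]
    simp [hΦ.centered]
  · intro v
    rw [(hG (some v)).map_eq_gaussianReal,
      ← covariance_self (hG (some v)).aemeasurable, covariance_innovation_some hX hΦ x hh hh',
      if_pos rfl]
    congr 1
    simp only [innovation]
    have hsum : Integrable
        (fun ω => 4 * h * Φ (point x v (1 / 4)) ω + (1 - 4 * h) * Φ (vertex x) ω) μ :=
      ((hi _).const_mul _).add ((hi _).const_mul _)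
    rw [integral_sub (hi _) hsum,
      integral_add ((hi _).const_mul _) ((hi _).const_mul _), integral_const_mul,
      integral_const_mul]
    simp [hΦ.centered]

end Innovation

/-! ### Gaussian estimates -/

/-- Two points of the joint window differ by at most `(M+2)h` and have sum at most `2B` in absolute
value, so their densities differ by a factor at most `e`. Lengths `2h` and `M h` then decide, at the
cost of a factor `e²`. -/
lemma gaussianReal_window_le {v : ℝ≥0} (hv : v ≠ 0) {r h M B q : ℝ} (hh : 0 < h) (hM : 0 ≤ M)
    (hB₁ : -B ≤ r - 2 * h) (hB₂ : r + M * h ≤ B)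
    (hB : (M + 2) * h * (2 * B) ≤ 2 * v) (hMq : 2 * Real.exp 1 ^ 2 ≤ M * q) :
    gaussianReal 0 v (Set.Ico (r - 2 * h) r) ≤
      gaussianReal 0 v (Set.Ico r (r + M * h)) * ENNReal.ofReal q := by
  have hv0 : (0 : ℝ) < v := by positivity
  have hMh : 0 ≤ M * h := by positivity
  have hcmp : ∀ x ∈ Set.Icc (r - 2 * h) (r + M * h), ∀ y ∈ Set.Icc (r - 2 * h) (r + M * h),
      gaussianPDFReal 0 v x ≤ Real.exp 1 * gaussianPDFReal 0 v y := by
    intro x hx y hy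
    simp only [gaussianPDFReal, sub_zero]
    rw [mul_left_comm, ← Real.exp_add]
    refine mul_le_mul_of_nonneg_left (Real.exp_le_exp.2 ?_) (by positivity)
    have h1 : |y - x| ≤ (M + 2) * h := abs_le.2 ⟨by linarith [hx.2, hy.1], by linarith [hx.1, hy.2]⟩
    have h2 : |y + x| ≤ 2 * B := abs_le.2 ⟨by linarith [hx.1, hy.1], by linarith [hx.2, hy.2]⟩
    have h3 : (y - x) * (y + x) ≤ 2 * v := by
      refine (le_abs_self _).trans (le_trans ?_ hB)
      rw [abs_mul]
      exact mul_le_mul h1 h2 (abs_nonneg _) (by positivity)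
    have h4 : (y ^ 2 - x ^ 2) / (2 * v) ≤ 1 := by
      rw [div_le_one (by positivity)]
      linarith
    have h5 : (y ^ 2 - x ^ 2) / (2 * v) = -x ^ 2 / (2 * v) - -y ^ 2 / (2 * v) := by ring
    linarith
  have hr : r ∈ Set.Icc (r - 2 * h) (r + M * h) := ⟨by linarith, by linarith⟩
  set ρ := gaussianPDFReal 0 v r with hρ
  have hρ0 : 0 ≤ ρ := gaussianPDFReal_nonneg _ _ _
  have hupper : gaussianReal 0 v (Set.Ico (r - 2 * h) r) ≤
      ENNReal.ofReal (Real.exp 1 * ρ * (2 * h)) := by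
    rw [gaussianReal_apply _ hv]
    calc ∫⁻ x in Set.Ico (r - 2 * h) r, gaussianPDF 0 v x
        ≤ ∫⁻ _ in Set.Ico (r - 2 * h) r, ENNReal.ofReal (Real.exp 1 * ρ) :=
          setLIntegral_mono measurable_const fun x hx => ENNReal.ofReal_le_ofReal
            (hcmp x ⟨hx.1, by linarith [hx.2]⟩ r hr)
      _ = ENNReal.ofReal (Real.exp 1 * ρ * (2 * h)) := by
          rw [setLIntegral_const, Real.volume_Ico, ← ENNReal.ofReal_mul (by positivity)]
          congr 2
          ring
  have hlower : ENNReal.ofReal ((Real.exp 1)⁻¹ * ρ * (M * h)) ≤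
      gaussianReal 0 v (Set.Ico r (r + M * h)) := by
    rw [gaussianReal_apply _ hv]
    calc ENNReal.ofReal ((Real.exp 1)⁻¹ * ρ * (M * h))
        = ∫⁻ _ in Set.Ico r (r + M * h), ENNReal.ofReal ((Real.exp 1)⁻¹ * ρ) := by
          rw [setLIntegral_const, Real.volume_Ico, ← ENNReal.ofReal_mul (by positivity)]
          congr 2
          ring
      _ ≤ ∫⁻ x in Set.Ico r (r + M * h), gaussianPDF 0 v x := by
          refine setLIntegral_mono (measurable_gaussianPDF 0 v) fun x hx =>
            ENNReal.ofReal_le_ofReal ?_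
          rw [inv_mul_le_iff₀ (Real.exp_pos 1)]
          exact hcmp r hr x ⟨by linarith [hx.1], hx.2.le⟩
  refine hupper.trans (le_trans ?_ (mul_le_mul_left hlower _))
  rw [← ENNReal.ofReal_mul (by positivity)]
  refine ENNReal.ofReal_le_ofReal ?_
  have he := Real.exp_pos 1
  have h1 : (Real.exp 1)⁻¹ * ρ * (M * h) * q = (Real.exp 1)⁻¹ * ρ * h * (M * q) := by ring
  have h2 : Real.exp 1 * ρ * (2 * h) = (Real.exp 1)⁻¹ * ρ * h * (2 * Real.exp 1 ^ 2) := by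
    field_simp
  rw [h1, h2]
  exact mul_le_mul_of_nonneg_left hMq (by positivity)

lemma gaussianReal_lower_tail_le {v : ℝ} {c : ℝ} (hv : 0 < v) (hc : c ≤ √v) :
    gaussianReal 0 1 (Set.Iio (-1)) ≤ gaussianReal 0 v.toNNReal (Set.Iio (-c)) := by
  have h := gaussianReal_map_const_mul (μ := 0) (v := 1) (√v)
  have h1 : (NNReal.mk (√v ^ 2) (sq_nonneg _) * 1 : ℝ≥0) = v.toNNReal := by
    ext
    simp [Real.sq_sqrt hv.le, hv.le]
  rw [mul_zero, h1] at h
  rw [← h, Measure.map_apply (measurable_const_mul _) measurableSet_Iio]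
  refine measure_mono fun x hx => ?_
  have h2 : √v * x < √v * (-1) := mul_lt_mul_of_pos_left hx (Real.sqrt_pos.2 hv)
  simp only [Set.mem_preimage, Set.mem_Iio]
  linarith

lemma gaussianReal_lower_tail_pos : 0 < (gaussianReal 0 1).real (Set.Iio (-1)) := by
  rw [measureReal_def, ENNReal.toReal_pos_iff]
  refine ⟨pos_iff_ne_zero.2 fun h => ?_, measure_lt_top _ _⟩
  have := gaussianReal_absolutelyContinuous' 0 one_ne_zero h
  simp at this

/-! ### Comparison of two windows -/

/-- Independence allows conditioning on `b = β`. Both fibres are then boxes for the product law of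
`Y`, so the claim reduces to the one-dimensional comparison `hwin` times the tail bounds `hq`. -/
lemma measure_window_le {Ω V : Type*} [MeasurableSpace Ω] [Fintype V] {μ : Measure Ω}
    [IsProbabilityMeasure μ] {Y : Option V → Ω → ℝ} {b : Ω → V → ℝ} (hY : ∀ o, Measurable (Y o))
    (hb : Measurable b) (hind : iIndepFun Y μ) (hbY : IndepFun b (fun ω o => Y o ω) μ)
    {T : Set (V → ℝ)} (hT : MeasurableSet T) {m : (V → ℝ) → ℝ} (hm : Measurable m)
    {p₁ p₂ p₃ c : ℝ} {q : ℝ≥0∞} (hq : ∀ v, q ≤ μ.map (Y (some v)) (Set.Iio (-c)))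
    (hwin : ∀ β ∈ T, μ.map (Y none) (Set.Ico (p₁ - m β) (p₂ - m β)) ≤
      μ.map (Y none) (Set.Ico (p₂ - m β) (p₃ - m β)) * q ^ Fintype.card V) :
    μ {ω | b ω ∈ T ∧ Y none ω + m (b ω) ∈ Set.Ico p₁ p₂} ≤
      μ {ω | b ω ∈ T ∧ Y none ω + m (b ω) ∈ Set.Ico p₂ p₃ ∧ ∀ v, Y (some v) ω < -c} := by
  have hYm : Measurable fun ω o => Y o ω := measurable_pi_lambda _ hY
  have hjoint := (indepFun_iff_map_prod_eq_prod_map_map hb.aemeasurable hYm.aemeasurable).1 hbY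
  have hpi := (iIndepFun_iff_map_fun_eq_pi_map fun o => (hY o).aemeasurable).1 hind
  have : ∀ o, IsProbabilityMeasure (μ.map (Y o)) := fun o =>
    Measure.isProbabilityMeasure_map (hY o).aemeasurable
  let S₁ : Set ((V → ℝ) × (Option V → ℝ)) := {p | p.1 ∈ T ∧ p.2 none + m p.1 ∈ Set.Ico p₁ p₂}
  let S₂ : Set ((V → ℝ) × (Option V → ℝ)) :=
    {p | p.1 ∈ T ∧ p.2 none + m p.1 ∈ Set.Ico p₂ p₃ ∧ ∀ v, p.2 (some v) < -c}
  have hsum : Measurable fun p : (V → ℝ) × (Option V → ℝ) => p.2 none + m p.1 :=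
    ((measurable_pi_apply none).comp measurable_snd).add (hm.comp measurable_fst)
  have hS₁ : MeasurableSet S₁ := (measurable_fst hT).inter (hsum measurableSet_Ico)
  have hS₂ : MeasurableSet S₂ := by
    refine (measurable_fst hT).inter ((hsum measurableSet_Ico).inter ?_)
    have : {p : (V → ℝ) × (Option V → ℝ) | ∀ v, p.2 (some v) < -c} =
        ⋂ v, (fun p : (V → ℝ) × (Option V → ℝ) => p.2 (some v)) ⁻¹' Set.Iio (-c) := by
      ext; simp
    change MeasurableSet {p : (V → ℝ) × (Option V → ℝ) | ∀ v, p.2 (some v) < -c}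
    rw [this]
    exact MeasurableSet.iInter fun v =>
      ((measurable_pi_apply (some v)).comp measurable_snd) measurableSet_Iio
  have hpre : ∀ S : Set ((V → ℝ) × (Option V → ℝ)), MeasurableSet S →
      μ ((fun ω => (b ω, fun o => Y o ω)) ⁻¹' S) =
        ∫⁻ β, (Measure.pi fun o => μ.map (Y o)) (Prod.mk β ⁻¹' S) ∂μ.map b := fun S hS => by
    rw [← Measure.map_apply (hb.prodMk hYm) hS, hjoint, hpi, Measure.prod_apply hS]
  refine (hpre S₁ hS₁).trans_le (le_trans (lintegral_mono fun β => ?_) (hpre S₂ hS₂).symm.le)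
  by_cases hβ : β ∈ T
  · have h1 : Prod.mk β ⁻¹' S₁ = Set.univ.pi fun o : Option V =>
        o.elim (Set.Ico (p₁ - m β) (p₂ - m β)) fun _ => Set.univ := by
      ext y
      simp [S₁, hβ, Option.forall, lt_sub_iff_add_lt]
    have h2 : Prod.mk β ⁻¹' S₂ = Set.univ.pi fun o : Option V =>
        o.elim (Set.Ico (p₂ - m β) (p₃ - m β)) fun _ => Set.Iio (-c) := by
      ext y
      simp [S₂, hβ, Option.forall, lt_sub_iff_add_lt]
    simp only
    rw [h1, h2, Measure.pi_pi, Measure.pi_pi, Fintype.prod_option, Fintype.prod_option]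
    simp only [Option.elim, measure_univ, Finset.prod_const_one, mul_one]
    refine (hwin β hβ).trans (mul_le_mul_right ?_ _)
    rw [← Finset.card_univ, ← Finset.prod_const]
    exact Finset.prod_le_prod' fun v _ => hq v
  · have h1 : Prod.mk β ⁻¹' S₁ = ∅ := by
      ext y
      simp [S₁, hβ]
    simp only
    rw [h1, measure_empty]
    exact zero_le

/-! ### The truncation height -/

/-- The square is `h log C₀ - c₀ h log h`, which tends to `0`. -/
lemma tendsto_sqrt_mul_truncation {C₀ c₀ : ℝ} (hC₀ : 1 ≤ C₀) :
    Filter.Tendsto (fun h => √h * truncation C₀ c₀ h) (nhdsWithin 0 (Set.Ioi 0)) (nhds 0) := by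
  have h1 : Filter.Tendsto (fun h : ℝ => h * Real.log C₀ - c₀ * (Real.log h * h))
      (nhdsWithin 0 (Set.Ioi 0)) (nhds 0) := by
    have h2 : Filter.Tendsto (fun h : ℝ => h) (nhdsWithin 0 (Set.Ioi 0)) (nhds 0) :=
      nhdsWithin_le_nhds
    have h3 := tendsto_log_mul_rpow_nhdsGT_zero zero_lt_one
    simp only [Real.rpow_one] at h3
    simpa using (h2.mul_const (Real.log C₀)).sub (h3.const_mul c₀)
  have h2 := h1.sqrt
  rw [Real.sqrt_zero] at h2
  refine h2.congr' ?_
  filter_upwards [self_mem_nhdsWithin] with h hh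
  have hh : 0 < h := hh
  rw [truncation, ← Real.sqrt_mul hh.le, Real.log_div (by linarith) (Real.rpow_pos_of_pos hh _).ne',
    Real.log_rpow hh]
  congr 1
  ring

/-- For small `h`, the quantities of order `h` times the truncation height are small. -/
lemma eventually_truncation_small {C₀ c₀ : ℝ} (hC₀ : 1 ≤ C₀) (M : ℝ) {δ : ℝ} (hδ : 0 < δ) :
    ∀ᶠ h in nhdsWithin (0 : ℝ) (Set.Ioi 0), h ≤ 1 / 8 ∧
      (M + 2) * h + 4 * h * truncation C₀ c₀ h ≤ √h ∧
      (M + 2) * h * (2 * (truncation C₀ c₀ h + (M + 1) * h)) ≤ δ := by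
  have hid : Filter.Tendsto (fun h : ℝ => h) (nhdsWithin 0 (Set.Ioi 0)) (nhds 0) :=
    nhdsWithin_le_nhds
  have hsq : Filter.Tendsto (fun h : ℝ => √h) (nhdsWithin 0 (Set.Ioi 0)) (nhds 0) := by
    simpa using hid.sqrt
  have hK := tendsto_sqrt_mul_truncation (c₀ := c₀) hC₀
  have h1 : Filter.Tendsto (fun h => (M + 2) * √h + 4 * (√h * truncation C₀ c₀ h))
      (nhdsWithin 0 (Set.Ioi 0)) (nhds 0) := by
    simpa using (hsq.const_mul (M + 2)).add (hK.const_mul 4)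
  have h2 : Filter.Tendsto (fun h => (M + 2) * (2 * (√h * (√h * truncation C₀ c₀ h) +
      (M + 1) * (h * h)))) (nhdsWithin 0 (Set.Ioi 0)) (nhds 0) := by
    simpa using (((hsq.mul hK).add ((hid.mul hid).const_mul (M + 1))).const_mul 2).const_mul (M + 2)
  filter_upwards [self_mem_nhdsWithin, hid (Iic_mem_nhds (show (0 : ℝ) < 1 / 8 by norm_num)),
    h1 (Iic_mem_nhds zero_lt_one), h2 (Iic_mem_nhds hδ)] with h h0 h3 h4 h5
  have h0 : 0 < h := h0
  have hs : √h * √h = h := Real.mul_self_sqrt h0.le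
  refine ⟨h3, ?_, ?_⟩
  · have h6 := mul_le_mul_of_nonneg_left (Set.mem_Iic.1 h4) (Real.sqrt_nonneg h)
    have h7 : √h * ((M + 2) * √h + 4 * (√h * truncation C₀ c₀ h)) =
        (M + 2) * (√h * √h) + 4 * (√h * √h) * truncation C₀ c₀ h := by ring
    rw [h7, hs, mul_one] at h6
    exact h6
  · have h7 : (M + 2) * (2 * (√h * (√h * truncation C₀ c₀ h) + (M + 1) * (h * h))) ≤ δ := h5
    have h6 : (M + 2) * (2 * (√h * (√h * truncation C₀ c₀ h) + (M + 1) * (h * h))) =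
        (M + 2) * (2 * ((√h * √h) * truncation C₀ c₀ h + (M + 1) * (h * h))) := by ring
    rw [h6, hs] at h7
    linarith

/-! ### The events -/

section Events

variable {Ω : Type*} [mΩ : MeasurableSpace Ω] {Φ : Cable d → Ω → ℝ}

lemma mem_arm (x : Fin d → ℤ) (v : V0 d) {t : ℝ} (h0 : 0 ≤ t) (h1 : t < 1 / 4) :
    point x v t ∈ arm x v := ⟨t, ⟨h0, h1⟩, rfl⟩

/-- By continuity of the field a countable dense set of points of the arm suffices. -/
lemma measurableSet_eventF (hΦ : ∀ z, Measurable (Φ z)) (hc : ∀ ω, Continuous fun z => Φ z ω)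
    (h : ℝ) (x : Fin d → ℤ) (v : V0 d) : MeasurableSet (eventF Φ h x v) := by
  have hne : Nonempty (Set.Ico (0 : ℝ) (1 / 4)) := ⟨⟨0, le_rfl, by norm_num⟩⟩
  have : eventF Φ h x v = ⋂ n, {ω | -h ≤
      Φ (point x v (TopologicalSpace.denseSeq (Set.Ico (0 : ℝ) (1 / 4)) n : ℝ)) ω} := by
    ext ω
    simp only [eventF, arm, Set.forall_mem_image, Set.mem_ofPred_eq, Set.mem_iInter]
    refine ⟨fun hω n => hω (TopologicalSpace.denseSeq (Set.Ico (0 : ℝ) (1 / 4)) n).2, fun hω t ht => ?_⟩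
    refine (TopologicalSpace.denseRange_denseSeq (Set.Ico (0 : ℝ) (1 / 4))).induction_on
      (p := fun s => -h ≤ Φ (point x v s) ω) ⟨t, ht⟩ (isClosed_le continuous_const ?_) hω
    exact (hc ω).comp ((continuous_point x v).comp continuous_subtype_val)
  rw [this]
  exact MeasurableSet.iInter fun n => measurableSet_le measurable_const (hΦ _)

variable [NeZero d]

omit mΩ in
lemma fieldSigma_starBoundary (x : Fin d → ℤ) :
    fieldSigma Φ (starBoundary x) =
      MeasurableSpace.comap (fun ω (v : V0 d) => Φ (point x v (1 / 4)) ω) inferInstance := by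
  simp only [fieldSigma, starBoundary_eq, iSup_range, MeasurableSpace.pi,
    MeasurableSpace.comap_iSup, MeasurableSpace.comap_comp]
  rfl

/-- The boundary values for which `eventE` holds. -/
def boundaryValues (d : ℕ) (C₀ c₀ h : ℝ) : Set (V0 d → ℝ) :=
  {β | (∃ v, -h ≤ β v) ∧ ∀ v, |β v| ≤ truncation C₀ c₀ h}

omit [NeZero d] in
lemma measurableSet_boundaryValues (C₀ c₀ h : ℝ) : MeasurableSet (boundaryValues d C₀ c₀ h) := by
  have : boundaryValues d C₀ c₀ h = (⋃ v, {β | -h ≤ β v}) ∩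
      ⋂ v, {β | |β v| ≤ truncation C₀ c₀ h} := by
    ext
    simp [boundaryValues]
  rw [this]
  exact (MeasurableSet.iUnion fun v => measurableSet_le measurable_const
    (measurable_pi_apply v)).inter (MeasurableSet.iInter fun v =>
      measurableSet_le (measurable_pi_apply v).abs measurable_const)

omit mΩ in
lemma mem_eventEdir_iff {C₀ c₀ h : ℝ} {x : Fin d → ℤ} {v : V0 d} {ω : Ω} :
    ω ∈ eventEdir Φ C₀ c₀ h x v ↔ -h ≤ Φ (point x v (1 / 4)) ω ∧
      ∀ w : V0 d, |Φ (point x w (1 / 4)) ω| ≤ truncation C₀ c₀ h := by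
  rw [eventEdir, starBoundary_eq]
  exact and_congr_right' Set.forall_mem_range

omit mΩ in
lemma eventE_eq_preimage (C₀ c₀ h : ℝ) (x : Fin d → ℤ) :
    eventE Φ C₀ c₀ h x =
      (fun ω (v : V0 d) => Φ (point x v (1 / 4)) ω) ⁻¹' boundaryValues d C₀ c₀ h := by
  ext ω
  simp only [eventE, Set.mem_iUnion, mem_eventEdir_iff, boundaryValues, Set.mem_preimage,
    Set.mem_ofPred_eq, exists_and_right]

lemma measurableSet_eventEdir (hΦ : ∀ z, Measurable (Φ z)) (C₀ c₀ h : ℝ) (x : Fin d → ℤ)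
    (v : V0 d) : MeasurableSet (eventEdir Φ C₀ c₀ h x v) := by
  have : eventEdir Φ C₀ c₀ h x v = {ω | -h ≤ Φ (point x v (1 / 4)) ω} ∩
      ⋂ w : V0 d, {ω | |Φ (point x w (1 / 4)) ω| ≤ truncation C₀ c₀ h} := by
    ext ω
    rw [mem_eventEdir_iff, Set.mem_inter_iff, Set.mem_iInter]
    rfl
  rw [this]
  exact (measurableSet_le measurable_const (hΦ _)).inter (MeasurableSet.iInter fun w =>
    measurableSet_le (hΦ _).abs measurable_const)

end Events

/-! ### Comparison of conditional probabilities -/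

/-- Both conditional expectations are `m`-measurable, so testing on sets of `m` is enough; passing
to the trimmed measure makes these all the measurable sets. -/
lemma condExp_indicator_le_of_forall_measure_le {Ω : Type*} {m mΩ : MeasurableSpace Ω}
    {μ : Measure Ω} [IsProbabilityMeasure μ] (hm : m ≤ mΩ) {A B : Set Ω} (hA : MeasurableSet A)
    (hB : MeasurableSet B) (h : ∀ s, MeasurableSet[m] s → μ (s ∩ A) ≤ μ (s ∩ B)) :
    μ⟦A | m⟧ ≤ᵐ[μ] μ⟦B | m⟧ := by
  refine ae_le_of_ae_le_trim (hm := hm) (ae_le_of_forall_setIntegral_le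
    (integrable_condExp.trim hm stronglyMeasurable_condExp)
    (integrable_condExp.trim hm stronglyMeasurable_condExp) fun s hs _ => ?_)
  have hint : ∀ D : Set Ω, MeasurableSet D →
      Integrable (D.indicator fun _ => (1 : ℝ)) μ := fun D hD =>
    (integrable_const 1).indicator hD
  rw [← setIntegral_trim hm stronglyMeasurable_condExp hs,
    ← setIntegral_trim hm stronglyMeasurable_condExp hs,
    setIntegral_condExp hm (hint A hA) hs, setIntegral_condExp hm (hint B hB) hs,
    setIntegral_indicator hA, setIntegral_indicator hB]
  simp only [setIntegral_const, smul_eq_mul, mul_one, measureReal_def]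
  exact ENNReal.toReal_mono (measure_ne_top _ _) (h s hs)

/-! ### The window comparison for the field -/

section Main

variable {W : Type*} [MeasurableSpace W] {P : Cable d → Measure W}
  {X : ℝ≥0 → W → Cable d} {L : ℝ≥0 → Cable d → W → ℝ≥0}
  {Ω : Type*} [MeasurableSpace Ω] {μ : Measure Ω} [IsProbabilityMeasure μ] {Φ : Cable d → Ω → ℝ}
  [NeZero d]

/-- Given the boundary values, the field at `x` is less likely to lie in `[-h, h)` than to lie in
`[h, ∞)` while the field drops below `-h` on every arm. -/
lemma measure_vertex_window_le (hX : IsCableDiffusion P X L)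
    (hΦ : IsGaussianField (green P L) μ Φ) (x : Fin d → ℤ) {h M K : ℝ} (hh : 0 < h) (hM : 0 ≤ M)
    (hh' : h ≤ 1 / 8)
    (hMq : 2 * Real.exp 1 ^ 2 ≤
      M * (gaussianReal 0 1).real (Set.Iio (-1)) ^ Fintype.card (V0 d))
    (htail : (M + 2) * h + 4 * h * K ≤ √h)
    (hwin : (M + 2) * h * (2 * (K + (M + 1) * h)) ≤ 1 / Fintype.card (V0 d))
    {T : Set (V0 d → ℝ)} (hT : MeasurableSet T) (hTK : ∀ β ∈ T, ∀ v, |β v| ≤ K) :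
    μ {ω | (fun v : V0 d => Φ (point x v (1 / 4)) ω) ∈ T ∧ Φ (vertex x) ω ∈ Set.Ico (-h) h} ≤
      μ {ω | (fun v : V0 d => Φ (point x v (1 / 4)) ω) ∈ T ∧ h ≤ Φ (vertex x) ω ∧
        ∀ v : V0 d, Φ (point x v h) ω < -h} := by
  have hh4 : h ≤ 1 / 4 := by linarith
  have hN : 0 < (Fintype.card (V0 d) : ℝ) := Nat.cast_pos.2 Fintype.card_pos
  set N : ℝ := (Fintype.card (V0 d) : ℝ) with hN_def
  let m : (V0 d → ℝ) → ℝ := fun β => N⁻¹ * ∑ v, β v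
  have hm : Measurable m :=
    (Finset.measurable_sum _ fun v _ => measurable_pi_apply v).const_mul _
  have hmK : ∀ β ∈ T, |m β| ≤ K := fun β hβ => by
    simp only [m]
    rw [abs_mul, abs_of_pos (inv_pos.2 hN), inv_mul_le_iff₀ hN]
    refine (Finset.abs_sum_le_sum_abs _ _).trans ((Finset.sum_le_sum fun v _ => hTK β hβ v).trans ?_)
    rw [Finset.sum_const, Finset.card_univ, nsmul_eq_mul]
  have hvert : ∀ ω, innovation Φ x h none ω + m (fun v => Φ (point x v (1 / 4)) ω) =
      Φ (vertex x) ω := fun ω => by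
    simp only [innovation, m]
    ring
  obtain ⟨hlaw, hlaw'⟩ := map_innovation hX hΦ x hh hh4
  have hb : Measurable fun ω (v : V0 d) => Φ (point x v (1 / 4)) ω :=
    measurable_pi_lambda _ fun v => hΦ.measurable _
  have hv0 : (1 / (2 * N) : ℝ).toNNReal ≠ 0 := by
    rw [Ne, Real.toNNReal_eq_zero, not_le]
    positivity
  have key := measure_window_le (fun o => measurable_innovation hΦ.measurable x h o) hb
    (iIndepFun_innovation hX hΦ x hh hh4) (indepFun_boundary_innovation hX hΦ x hh hh4) hT hm
    (p₁ := -h) (p₂ := h) (p₃ := (M + 1) * h) (c := (M + 2) * h + 4 * h * K)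
    (q := gaussianReal 0 1 (Set.Iio (-1))) (fun v => by
      rw [hlaw' v]
      -- As `h ≤ 1/8`, the bridge variance `2h(1-4h)` is at least `h`, so the required drop, at most
      -- `√h`, is within one standard deviation.
      refine gaussianReal_lower_tail_le (mul_pos (by linarith) (by linarith))
        (htail.trans (Real.sqrt_le_sqrt ?_))
      nlinarith) (fun β hβ => by
      have hmβ := abs_le.1 (hmK β hβ)
      have hw := gaussianReal_window_le hv0 (r := h - m β) (B := K + (M + 1) * h)
        (q := (gaussianReal 0 1).real (Set.Iio (-1)) ^ Fintype.card (V0 d)) hh hM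
        (by nlinarith [hmβ.2]) (by nlinarith [hmβ.1]) (by
          rw [Real.coe_toNNReal _ (by positivity)]
          refine hwin.trans (le_of_eq ?_)
          field_simp) hMq
      rw [ENNReal.ofReal_pow measureReal_nonneg, ofReal_measureReal] at hw
      rw [hlaw]
      convert hw using 3
      · ring_nf
      · ring_nf)
  simp only [hvert] at key
  -- On the second window the interpolation is at most `4hK + (M+1)h`, so an innovation below
  -- `-((M+2)h + 4hK)` brings the field below `-h`.
  refine key.trans (measure_mono fun ω ⟨h1, h2, h3⟩ => ⟨h1, h2.1, fun v => ?_⟩)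
  have h4 := h3 v
  simp only [innovation] at h4
  have h5 : 4 * h * Φ (point x v (1 / 4)) ω ≤ 4 * h * K :=
    mul_le_mul_of_nonneg_left ((le_abs_self _).trans (hTK _ h1 v)) (by linarith)
  have h6 : (1 - 4 * h) * Φ (vertex x) ω ≤ (M + 1) * h := by
    have h7 : 0 ≤ Φ (vertex x) ω := hh.le.trans h2.1
    have h8 : 0 ≤ 4 * h * Φ (vertex x) ω := by positivity
    linarith [h2.2]
  linarith

end Main

end CableGFF

end

theorem lemma5p1 (d : ℕ) (hd : 3 ≤ d) (C₀ c₀ : ℝ) (hC₀ : 1 ≤ C₀) (hc₀ : 0 < c₀) :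
    ∃ h₁ ∈ Set.Ioc (0 : ℝ) 1,
      ∀ (W : Type*) [MeasurableSpace W] (P : CableGFF.Cable d → Measure W)
        (X : ℝ≥0 → W → CableGFF.Cable d) (L : ℝ≥0 → CableGFF.Cable d → W → ℝ≥0)
        (_ : CableGFF.IsCableDiffusion P X L)
        (Ω : Type*) [MeasurableSpace Ω] (μ : Measure Ω) [IsProbabilityMeasure μ]
        (Φ : CableGFF.Cable d → Ω → ℝ)
        (_ : CableGFF.IsGaussianField (CableGFF.green P L) μ Φ),
        ∀ h ∈ Set.Ioc 0 h₁, ∀ x : Fin d → ℤ,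
          μ⟦CableGFF.eventG Φ C₀ c₀ h x | CableGFF.fieldSigma Φ (CableGFF.starBoundary x)⟧
            ≤ᵐ[μ]
          μ⟦CableGFF.eventE Φ C₀ c₀ h x ∩ {ω | h ≤ Φ (CableGFF.vertex x) ω} |
            CableGFF.fieldSigma Φ (CableGFF.starBoundary x)⟧ := by
  open CableGFF in
  have : NeZero d := ⟨by omega⟩
  have hq := pow_pos gaussianReal_lower_tail_pos (Fintype.card (V0 d))
  set q : ℝ := (gaussianReal 0 1).real (Set.Iio (-1)) ^ Fintype.card (V0 d) with hq_def
  set M : ℝ := 2 * Real.exp 1 ^ 2 / q with hM_def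
  have hM : 0 ≤ M := by positivity
  have hMq : 2 * Real.exp 1 ^ 2 ≤ M * q := by rw [hM_def, div_mul_cancel₀ _ hq.ne']
  have hN : 0 < (Fintype.card (V0 d) : ℝ) := Nat.cast_pos.2 Fintype.card_pos
  obtain ⟨u, hu, hsub⟩ := mem_nhdsGT_iff_exists_Ioc_subset.1
    (eventually_truncation_small (c₀ := c₀) hC₀ M (one_div_pos.2 hN))
  refine ⟨min u 1, ⟨lt_min hu one_pos, min_le_right _ _⟩, ?_⟩
  intro W _ P X L hX Ω _ μ _ Φ hΦ h hh x
  have hh0 : 0 < h := hh.1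
  obtain ⟨hh8, htail, hwin⟩ := hsub ⟨hh0, hh.2.trans (min_le_left _ _)⟩
  have hb : Measurable fun ω (v : V0 d) => Φ (point x v (1 / 4)) ω :=
    measurable_pi_lambda _ fun v => hΦ.measurable _
  have hA : MeasurableSet {ω | h ≤ Φ (vertex x) ω} :=
    measurableSet_le measurable_const (hΦ.measurable _)
  have hE : MeasurableSet (eventE Φ C₀ c₀ h x) := by
    rw [eventE_eq_preimage]
    exact hb (measurableSet_boundaryValues C₀ c₀ h)
  have hG : MeasurableSet (eventG Φ C₀ c₀ h x) := MeasurableSet.iUnion fun v =>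
    (measurableSet_eventEdir hΦ.measurable C₀ c₀ h x v).inter
      (measurableSet_eventF hΦ.measurable hΦ.continuous h x v)
  rw [fieldSigma_starBoundary]
  refine condExp_indicator_le_of_forall_measure_le hb.comap_le hG (hE.inter hA) fun s hs => ?_
  obtain ⟨S, hS, rfl⟩ := hs
  have hGE : eventG Φ C₀ c₀ h x ⊆ eventE Φ C₀ c₀ h x := Set.iUnion_mono fun v _ hω => hω.1
  have hF : ∀ ω ∈ eventG Φ C₀ c₀ h x, ∃ v, ∀ t : ℝ, 0 ≤ t → t < 1 / 4 →
      -h ≤ Φ (point x v t) ω := fun ω hω => by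
    obtain ⟨v, hv⟩ := Set.mem_iUnion.1 hω
    exact ⟨v, fun t h0 h1 => hv.2 _ (mem_arm x v h0 h1)⟩
  -- Here `S` is an arbitrary set of boundary values, so the bound is obtained on every set of the
  -- conditioning σ-algebra.
  have key := measure_vertex_window_le hX hΦ x hh0 hM hh8 hMq htail hwin
    (hS.inter (measurableSet_boundaryValues C₀ c₀ h)) fun β hβ => hβ.2.2
  set b : Ω → V0 d → ℝ := fun ω v => Φ (point x v (1 / 4)) ω
  set low : Set Ω := {ω | b ω ∈ S ∩ boundaryValues d C₀ c₀ h ∧ Φ (vertex x) ω ∈ Set.Ico (-h) h}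
  set high : Set Ω := {ω | b ω ∈ S ∩ boundaryValues d C₀ c₀ h ∧ h ≤ Φ (vertex x) ω ∧
    ∀ v : V0 d, Φ (point x v h) ω < -h}
  have hhigh : MeasurableSet high := by
    refine (hb (hS.inter (measurableSet_boundaryValues C₀ c₀ h))).inter (hA.inter ?_)
    have : {ω | ∀ v : V0 d, Φ (point x v h) ω < -h} = ⋂ v : V0 d, {ω | Φ (point x v h) ω < -h} := by
      ext
      simp only [Set.mem_iInter, Set.mem_ofPred_eq]
    change MeasurableSet {ω | ∀ v : V0 d, Φ (point x v h) ω < -h}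
    rw [this]
    exact MeasurableSet.iInter fun v => measurableSet_lt (hΦ.measurable _) measurable_const
  -- `G_h^x` keeps the field at least `-h` along a whole arm, including distance `h < 1/4`, which
  -- `high` excludes on every arm.
  have hdisj : Disjoint (b ⁻¹' S ∩ eventG Φ C₀ c₀ h x ∩ {ω | h ≤ Φ (vertex x) ω}) high := by
    refine Set.disjoint_left.2 fun ω h1 h2 => ?_
    obtain ⟨v, hv⟩ := hF ω h1.1.2
    exact absurd (hv h hh0.le (by linarith)) (not_le.2 (h2.2.2 v))
  calc μ (b ⁻¹' S ∩ eventG Φ C₀ c₀ h x)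
      ≤ μ (b ⁻¹' S ∩ eventG Φ C₀ c₀ h x ∩ {ω | h ≤ Φ (vertex x) ω} ∪ low) := by
        refine measure_mono fun ω hω => ?_
        by_cases hω' : h ≤ Φ (vertex x) ω
        · exact Or.inl ⟨hω, hω'⟩
        · obtain ⟨v, hv⟩ := hF ω hω.2
          -- The arm starts at `x` itself, so `Φ_x ≥ -h`.
          have h0 := hv 0 le_rfl (by norm_num)
          rw [point_zero] at h0
          have hωE := hGE hω.2
          rw [eventE_eq_preimage] at hωE
          exact Or.inr ⟨⟨hω.1, hωE⟩, h0, not_le.1 hω'⟩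
    _ ≤ μ (b ⁻¹' S ∩ eventG Φ C₀ c₀ h x ∩ {ω | h ≤ Φ (vertex x) ω}) + μ low :=
        measure_union_le _ _
    _ ≤ μ (b ⁻¹' S ∩ eventG Φ C₀ c₀ h x ∩ {ω | h ≤ Φ (vertex x) ω}) + μ high := by gcongr
    _ = μ (b ⁻¹' S ∩ eventG Φ C₀ c₀ h x ∩ {ω | h ≤ Φ (vertex x) ω} ∪ high) :=
        (measure_union hdisj hhigh).symm
    _ ≤ μ (b ⁻¹' S ∩ (eventE Φ C₀ c₀ h x ∩ {ω | h ≤ Φ (vertex x) ω})) := by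
        refine measure_mono fun ω hω => ?_
        rcases hω with hω | hω
        · exact ⟨hω.1.1, hGE hω.1.2, hω.2⟩
        · refine ⟨hω.1.1, ?_, hω.2.1⟩
          rw [eventE_eq_preimage]
          exact hω.1.2
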